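/- **Setting.** Fix $\tau\in(0,1)$ and integers $D,R$. Let $\rho_\tau(u)=(\tau-\mathbf 1\{u\le 0\})u$. For units $i=1,2,\dots$ and periods $t=1,\dots,T$, where $T=T_n\ge1$ is either fixed or tends to infinity as $n\to\infty$, $$y_{it}=\theta_{0t}(x_i)+u_{it},\qquad \theta_{0t}(x)=\sum_{r=1}^R g_r(x)f_{tr},\qquad g_r(x)=\sum_{d=1}^D g_{rd}(x_d),$$ where $x_i$ is a random vector with support $\mathcal X\subset\mathbb R^D$, the $f_t=(f_{t1},\dots,f_{tR})'\in\mathbb R^R$ are non-random, and $P[u_{it}\le0\mid x_i=x]=\tau$ for all $x\in\mathcal X$. Let $\Theta$ be a set of continuous functions on $\mathcal X$ with $\theta_{0t}\in\Theta$ for all $t\le T$, let $\phi_1,\dots,\phi_{k_n}$ be continuous functions on $\mathbb R$ (they may depend on $n$), and let $$\Theta_n=\Big\{h\in\Theta:\ h(x)=\sum_{d=1}^D\sum_{j=1}^{k_n}a_{jd}\phi_j(x_d)\ \text{ on } \mathcal X \text{ for some } (a_{jd})\in\mathbb R^{Dk_n}\Big\}.$$ The first-step estimators $\hat\theta_{nt}$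 satisfy, with probability tending to one and for all $t\le T$, $\hat\theta_{nt}\in\Theta_n$ and $L_{nt}(\hat\theta_{nt})\le\inf_{\theta\in\Theta_n}L_{nt}(\theta)$, where $L_{nt}(\theta)=n^{-1}\sum_{i=1}^n\{\rho_\tau(y_{it}-\theta(x_i))-\rho_\tau(y_{it}-\theta_{0t}(x_i))\}$. (In particular this covers minimizers over all coefficient vectors in $\mathbb R^{Dk_n}$ whenever, with probability tending to one, they lie in $\Theta$ for all $t\le T$.) Put $d(\theta_1,\theta_2)=\sqrt{\mathbb E(\theta_1(x_1)-\theta_2(x_1))^2}$ for $\theta_1,\theta_2\in\Theta$, and, for a constant $\alpha\ge1$, $$\varepsilon_n=\sqrt{k_n/n}\vee k_n^{-\alpha},\qquad \varepsilon_{nT}=(\sqrt{\ln T}\vee1)\,\varepsilon_n .$$ **Assumptions.** (i) The vectors $z_i=(u_{i1},\dots,u_{iT},x_i)$, $i=1,\dots,n$, are i.i.d., and for each $i$ the distributions of $(u_{i1},x_i),\dots,(u_{iT},x_i)$ are identical. (ii) There are coefficients $b_{r}=(b_{r,jd})\in\mathbb R^{Dk_n}$, $r=1,\dots,R$ (depending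 on $n$), with $\max_{r}\sup_{x\in\mathcal X}|g_r(x)-\sum_{d,j}b_{r,jd}\phi_j(x_d)|=O(k_n^{-\alpha})$, and for all large $n$ the approximants $\pi_n\theta_{0t}(x)=\sum_r f_{tr}\sum_{d,j}b_{r,jd}\phi_j(x_d)$ belong to $\Theta_n$ for all $t\le T$. (iii) $\mathcal X$ is bounded, and for some constant $M$: $\sup_{\theta\in\Theta}\sup_{x\in\mathcal X}|\theta(x)|<M$ and $\|f_t\|<M$ for all $t\le T$. (iv) Given $x_i=x$, $u_{it}$ has a conditional density $\mathsf f(\cdot|x)$ (the same for all $i,t$) with $0<\inf_{x\in\mathcal X}\mathsf f(0|x)\le\sup_{x\in\mathcal X}\mathsf f(0|x)<\infty$ and $\sup_{x\in\mathcal X}|\mathsf f(z|x)-\mathsf f(0|x)|\to0$ as $|z|\to0$. (v) $k_n\to\infty$ and $\varepsilon_{nT}\to0$ as $n\to\infty$. **Proposition 1.** Under these assumptions, $$\max_{1\le t\le T}d(\hat\theta_{nt},\theta_{0t})=O_P(\varepsilon_{nT})\qquad\text{as } n\to\infty .$$ -/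

import Mathlib

open MeasureTheory ProbabilityTheory Filter Topology

noncomputable section

/-- The check function `ρ_τ(u) = (τ - 1{u ≤ 0}) u`. -/
def checkLoss (τ u : ℝ) : ℝ := (τ - if u ≤ 0 then 1 else 0) * u

/-- The additive sieve function `x ↦ ∑_d ∑_j a_{dj} φ_j(x_d)` on `𝒳 ⊆ ℝ^D`. -/
def sieveFun {D k : ℕ} (𝒳 : Set (EuclideanSpace ℝ (Fin D))) (φ : Fin k → C(ℝ, ℝ))
    (a : Fin D → Fin k → ℝ) : C(𝒳, ℝ) where
  toFun x := ∑ d, ∑ j, a d j * φ j ((x : EuclideanSpace ℝ (Fin D)) d)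
  continuous_toFun := by fun_prop

/-- The linear space of all additive sieve functions, with unrestricted coefficients. -/
def sieveSpan {D k : ℕ} (𝒳 : Set (EuclideanSpace ℝ (Fin D))) (φ : Fin k → C(ℝ, ℝ)) :
    Set C(𝒳, ℝ) :=
  Set.range (sieveFun 𝒳 φ)

/-- The sieve `Θ_n ⊆ Θ`: the additive sieve functions that belong to the parameter space. -/
def sieveSet {D k : ℕ} {𝒳 : Set (EuclideanSpace ℝ (Fin D))} (Θ : Set C(𝒳, ℝ))
    (φ : Fin k → C(ℝ, ℝ)) : Set C(𝒳, ℝ) :=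
  sieveSpan 𝒳 φ ∩ Θ

/-- `L_n(θ) = n⁻¹ ∑_{i<n} (ρ_τ(y_i - θ(x_i)) - ρ_τ(y_i - θ₀(x_i)))`. -/
def sampleCriterion {S : Type*} (τ : ℝ) (n : ℕ) (y : ℕ → ℝ) (x : ℕ → S) (θ₀ θ : S → ℝ) : ℝ :=
  (n : ℝ)⁻¹ * ∑ i ∈ Finset.range n,
    (checkLoss τ (y i - θ (x i)) - checkLoss τ (y i - θ₀ (x i)))

/-- `θhat` belongs to the set `A` and minimizes the sample criterion over `A`. -/
def IsSieveEstimator {S : Type*} [TopologicalSpace S] (τ : ℝ) (n : ℕ) (y : ℕ → ℝ) (x : ℕ → S)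
    (θ₀ : S → ℝ) (A : Set C(S, ℝ)) (θhat : C(S, ℝ)) : Prop :=
  θhat ∈ A ∧ ∀ θ ∈ A, sampleCriterion τ n y x θ₀ θhat ≤ sampleCriterion τ n y x θ₀ θ

/-- The `L²` pseudo-metric `d(θ₁, θ₂) = (E (θ₁(x) - θ₂(x))²)^{1/2}`, where `x` has law `ν`. -/
def l2Dist {S : Type*} [MeasurableSpace S] (ν : Measure S) (θ₁ θ₂ : S → ℝ) : ℝ :=
  √(∫ x, (θ₁ x - θ₂ x) ^ 2 ∂ν)

/-- `ε_n = √(k/n) ∨ k^{-α}`. -/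
def sieveRate (α : ℝ) (n k : ℕ) : ℝ := max √((k : ℝ) / n) ((k : ℝ) ^ (-α))

/-- `ε_{nT} = (√(ln T) ∨ 1) · ε_n`. -/
def panelRate (α : ℝ) (n k T : ℕ) : ℝ := max √(Real.log T) 1 * sieveRate α n k

/-- `X_n = O_P(a_n)` as `n → ∞`; for non-measurable `X_n`, `P` is the outer probability. -/
def IsBigOP {Ω : Type*} [MeasurableSpace Ω] (P : Measure Ω) (X : ℕ → Ω → ℝ) (a : ℕ → ℝ) : Prop :=
  ∀ δ : ℝ, 0 < δ → ∃ C : ℝ, 0 < C ∧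
    ∀ᶠ n in atTop, P {ω | C * a n < |X n ω|} ≤ ENNReal.ofReal δ

end

/-! The estimator's empirical loss does not exceed that of the approximant `π_n θ₀`, so its
population excess loss over `π_n θ₀` is at most a deviation between population and empirical means.
The population excess over `θ₀` is of the order of `d²`: the quantile restriction removes the linear
term in Knight's identity, and the density near `0` makes the remainder quadratic
(`mul_sq_le_integral_checkLoss_sub`, `integral_checkLoss_sub_le`). It remains to bound the deviation
by a small multiple of `d²` plus a term of order `(k_n + ln T) / n` and the squared approximation
error.

This needs neither chaining nor peeling. The deviation is offset by a multiple of the squared norm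
of `θ - π_n θ₀`, and the exponential moment of the supremum of this offset process is bounded
directly. Symmetrization and contraction, one coordinate at a time (`lintegral_expMax_offset_le`,
`lintegral_expMax_pi_le`), replace the loss by a random sign times a multiple of `θ - π_n θ₀`, with
a quadratic penalty in the empirical norm. For a fixed sample the vectors of values of `θ - π_n θ₀`
lie in a space of dimension at most `D k_n`. Completing the square bounds the supremum by a quarter
of the squared norm of a projected sign vector, whose exponential moment is at most `K ^ (D k_n)`
with `K = gaussianExpSq` (`rademacher_expMax_offset_le`).

Markov's inequality then gives the tail `exp (-s) K ^ (D k_n)` for each period. A union bound over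
the periods, with `s` of order `ln T + k_n`, yields the rate; only the law of each single
cross-section enters, so dependence between periods is harmless. The oracle inequality
`l2Dist_sq_le_of_offsetExcess_le` combines the pieces. -/

/-- The maximum over a finite set of the exponentials `exp (a t)`, as an extended nonnegative
real (equal to `0` over the empty set). -/
noncomputable def expMax {ι : Type*} (G : Finset ι) (a : ι → ℝ) : ENNReal :=
  G.sup fun t => ENNReal.ofReal (Real.exp (a t))

/-- The sign `1` or `-1` encoded by a Boolean. -/
def boolSign (b : Bool) : ℝ := if b then 1 else -1

/-! ### Symmetrization and contraction for exponential maxima. -/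

section ExpMax

variable {ι : Type*}

theorem le_expMax {G : Finset ι} {t : ι} (ht : t ∈ G) (a : ι → ℝ) :
    ENNReal.ofReal (Real.exp (a t)) ≤ expMax G a :=
  Finset.le_sup (f := fun t => ENNReal.ofReal (Real.exp (a t))) ht

theorem expMax_le {G : Finset ι} {a : ι → ℝ} {c : ENNReal}
    (h : ∀ t ∈ G, ENNReal.ofReal (Real.exp (a t)) ≤ c) : expMax G a ≤ c :=
  Finset.sup_le h

theorem exists_expMax_eq {G : Finset ι} (hG : G.Nonempty) (a : ι → ℝ) :
    ∃ t ∈ G, expMax G a = ENNReal.ofReal (Real.exp (a t)) ∧ ∀ s ∈ G, a s ≤ a t := by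
  obtain ⟨t, ht, hmax⟩ := G.exists_max_image a hG
  exact ⟨t, ht, le_antisymm
    (expMax_le fun s hs => ENNReal.ofReal_le_ofReal (Real.exp_le_exp.2 (hmax s hs)))
    (le_expMax ht a), hmax⟩

theorem measurable_expMax {Z : Type*} [MeasurableSpace Z] (G : Finset ι) {a : Z → ι → ℝ}
    (ha : ∀ t, Measurable fun z => a z t) : Measurable fun z => expMax G (a z) := by
  have : (fun z => expMax G (a z)) =
      G.sup fun t z => ENNReal.ofReal (Real.exp (a z t)) := by
    ext z
    simp [expMax, Finset.sup_apply]
  rw [this]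
  exact Finset.sup_induction measurable_const (fun _ hf _ hg => hf.sup hg)
    fun t _ => ((ha t).exp).ennreal_ofReal

/-- Increasing convex functions respect weak majorization. In the main case `V ≤ p ≤ U`, it is the
expansion of `(exp U - exp p) * (exp p - exp V) ≥ 0`, after replacing `q` by its largest possible
value `U + V - p`. -/
theorem exp_add_exp_le_of_weakly_majorized {p q U V : ℝ} (hp : p ≤ max U V) (hq : q ≤ max U V)
    (h : p + q ≤ U + V) : Real.exp p + Real.exp q ≤ Real.exp U + Real.exp V := by
  wlog hUV : V ≤ U generalizing U V
  · rw [add_comm (Real.exp U)]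
    exact this (by rwa [max_comm]) (by rwa [max_comm]) (by linarith) (le_of_not_ge hUV)
  wlog hqp : q ≤ p generalizing p q
  · rw [add_comm (Real.exp p)]
    exact this hq hp (by linarith) (le_of_not_ge hqp)
  rw [max_eq_left hUV] at hp hq
  rcases le_total p V with hpV | hVp
  · exact add_le_add (Real.exp_le_exp.2 hp) (Real.exp_le_exp.2 (hqp.trans hpV))
  · have h1 : Real.exp q ≤ Real.exp (U + V - p) := Real.exp_le_exp.2 (by linarith)
    have h2 : Real.exp (U + V - p) * Real.exp p = Real.exp U * Real.exp V := by
      rw [← Real.exp_add, ← Real.exp_add]; ring_nf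
    have h3 := Real.exp_le_exp.2 hp
    have h4 := Real.exp_le_exp.2 hVp
    have h5 : Real.exp p * (Real.exp p + Real.exp (U + V - p)) ≤
        Real.exp p * (Real.exp U + Real.exp V) := by
      nlinarith [mul_nonneg (sub_nonneg.2 h3) (sub_nonneg.2 h4)]
    have h6 := le_of_mul_le_mul_left h5 (Real.exp_pos p)
    linarith

/-- A contraction inequality for a single random sign. -/
theorem expMax_contraction (G : Finset ι) {a f h : ι → ℝ} (hf : ∀ t ∈ G, |f t| ≤ |h t|)
    (hfh : ∀ s ∈ G, ∀ t ∈ G, |f s - f t| ≤ |h s - h t|) :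
    expMax G (fun t => a t + f t) + expMax G (fun t => a t - f t) ≤
      expMax G (fun t => a t + h t) + expMax G (fun t => a t - h t) := by
  rcases G.eq_empty_or_nonempty with rfl | hG
  · simp [expMax]
  obtain ⟨t, ht, et, -⟩ := exists_expMax_eq hG fun t => a t + f t
  obtain ⟨s, hs, es, -⟩ := exists_expMax_eq hG fun t => a t - f t
  obtain ⟨t', -, et', mt'⟩ := exists_expMax_eq hG fun t => a t + h t
  obtain ⟨s', -, es', ms'⟩ := exists_expMax_eq hG fun t => a t - h t
  rw [et, es, et', es', ← ENNReal.ofReal_add (Real.exp_pos _).le (Real.exp_pos _).le,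
    ← ENNReal.ofReal_add (Real.exp_pos _).le (Real.exp_pos _).le]
  -- The maximizers on the left give exponents weakly majorized by the two maxima on the right:
  -- domination bounds each exponent, and the Lipschitz condition bounds their sum.
  refine ENNReal.ofReal_le_ofReal (exp_add_exp_le_of_weakly_majorized ?_ ?_ ?_)
  · have h1 := mt' t ht
    have h2 := ms' t ht
    have h3 := (abs_le.1 (hf t ht)).2
    rcases abs_cases (h t) with ⟨h4, -⟩ | ⟨h4, -⟩
    · exact le_max_of_le_left (by linarith)
    · exact le_max_of_le_right (by linarith)
  · have h1 := mt' s hs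
    have h2 := ms' s hs
    have h3 := (abs_le.1 (hf s hs)).1
    rcases abs_cases (h s) with ⟨h4, -⟩ | ⟨h4, -⟩
    · exact le_max_of_le_left (by linarith)
    · exact le_max_of_le_right (by linarith)
  · have h1 := mt' t ht
    have h2 := ms' t ht
    have h3 := mt' s hs
    have h4 := ms' s hs
    have h5 := (abs_le.1 (hfh t ht s hs)).2
    rcases abs_cases (h t - h s) with ⟨h6, -⟩ | ⟨h6, -⟩ <;> linarith

variable {Z : Type*} [MeasurableSpace Z] (μ : Measure Z) [IsProbabilityMeasure μ]

theorem ofReal_exp_integral_le {w : Z → ℝ} (hw : Measurable w) {B : ℝ} (hB : ∀ z, |w z| ≤ B) :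
    ENNReal.ofReal (Real.exp (∫ z, w z ∂μ)) ≤ ∫⁻ z, ENNReal.ofReal (Real.exp (w z)) ∂μ := by
  have hwi : Integrable w μ :=
    Integrable.of_bound hw.aestronglyMeasurable B (Eventually.of_forall hB)
  have hei : Integrable (fun z => Real.exp (w z)) μ := by
    refine Integrable.of_bound hw.exp.aestronglyMeasurable (Real.exp B)
      (Eventually.of_forall fun z => ?_)
    rw [Real.norm_eq_abs, Real.abs_exp]
    exact Real.exp_le_exp.2 ((le_abs_self _).trans (hB z))
  rw [← ofReal_integral_eq_lintegral_ofReal hei (Eventually.of_forall fun _ => (Real.exp_pos _).le)]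
  exact ENNReal.ofReal_le_ofReal (convexOn_exp.map_integral_le Real.continuous_exp.continuousOn
    isClosed_univ (Eventually.of_forall fun _ => Set.mem_univ _) hwi hei)

/-- Symmetrization and contraction of an offset process in one coordinate. -/
theorem lintegral_expMax_offset_le (G : Finset ι) {f g h : ι → Z → ℝ} {B : ℝ}
    (hfm : ∀ t, Measurable (f t)) (hgm : ∀ t, Measurable (g t))
    (hfB : ∀ t z, |f t z| ≤ B) (hgB : ∀ t z, |g t z| ≤ B)
    (hf : ∀ t z, |f t z| ≤ |h t z|) (hfh : ∀ s t z, |f s z - f t z| ≤ |h s z - h t z|)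
    (A : ι → ℝ) :
    ∫⁻ z, expMax G (fun t => A t + (∫ z', f t z' ∂μ - f t z - ∫ z', g t z' ∂μ - g t z)) ∂μ ≤
      ∫⁻ z, 2⁻¹ * ∑ b : Bool, expMax G (fun t => A t + (2 * boolSign b * h t z - 2 * g t z)) ∂μ := by
  set a : Z → ι → ℝ := fun z t => A t - 2 * g t z with ha
  set I : ENNReal := ∫⁻ z, expMax G (fun t => a z t + 2 * f t z) ∂μ with hI
  -- The exponent is the midpoint of `A + 2 P f - 2 P g` and `A - 2 f(z) - 2 g(z)`. Convexity of
  -- `exp` separates the two, and Jensen's inequality bounds the first by `I`, so no ghost sample is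
  -- needed.
  have key : ∀ z, expMax G
      (fun t => A t + (∫ z', f t z' ∂μ - f t z - ∫ z', g t z' ∂μ - g t z)) ≤
      2⁻¹ * (I + expMax G (fun t => a z t - 2 * f t z)) := by
    intro z
    refine expMax_le fun t ht => ?_
    have hint : ∫ z', (A t + (2 * f t z' - 2 * g t z')) ∂μ =
        A t + (2 * ∫ z', f t z' ∂μ - 2 * ∫ z', g t z' ∂μ) := by
      have i1 : Integrable (f t) μ :=
        Integrable.of_bound (hfm t).aestronglyMeasurable B (Eventually.of_forall (hfB t))
      have i2 : Integrable (g t) μ :=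
        Integrable.of_bound (hgm t).aestronglyMeasurable B (Eventually.of_forall (hgB t))
      have i3 : Integrable (fun z => 2 * f t z - 2 * g t z) μ := (i1.const_mul 2).sub (i2.const_mul 2)
      rw [integral_add (integrable_const _) i3,
        integral_sub (i1.const_mul 2) (i2.const_mul 2), integral_const_mul, integral_const_mul]
      simp
    have hJ : ENNReal.ofReal (Real.exp (A t + (2 * ∫ z', f t z' ∂μ - 2 * ∫ z', g t z' ∂μ))) ≤ I := by
      rw [← hint]
      refine (ofReal_exp_integral_le μ (B := |A t| + 4 * B) ?_ fun z' => ?_).trans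
        (lintegral_mono fun z' => ?_)
      · exact ((hfm t).const_mul 2 |>.sub ((hgm t).const_mul 2)).const_add _
      · have h1 := abs_le.1 (hfB t z')
        have h2 := abs_le.1 (hgB t z')
        have h3 := abs_le.1 (le_refl |A t|)
        rw [abs_le]
        constructor <;> linarith
      · refine (le_of_eq ?_).trans (le_expMax ht fun t => a z' t + 2 * f t z')
        simp only [ha]
        ring_nf
    have hconv : ∀ p q : ℝ, ENNReal.ofReal (Real.exp ((p + q) / 2)) ≤
        2⁻¹ * (ENNReal.ofReal (Real.exp p) + ENNReal.ofReal (Real.exp q)) := by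
      intro p q
      rw [← ENNReal.ofReal_add (Real.exp_pos _).le (Real.exp_pos _).le,
        show (2⁻¹ : ENNReal) = ENNReal.ofReal 2⁻¹ by
          rw [ENNReal.ofReal_inv_of_pos two_pos]; simp,
        ← ENNReal.ofReal_mul (by norm_num)]
      refine ENNReal.ofReal_le_ofReal ?_
      have e1 : Real.exp p = Real.exp (p / 2) ^ 2 := by rw [← Real.exp_nat_mul]; ring_nf
      have e2 : Real.exp q = Real.exp (q / 2) ^ 2 := by rw [← Real.exp_nat_mul]; ring_nf
      have e3 : Real.exp ((p + q) / 2) = Real.exp (p / 2) * Real.exp (q / 2) := by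
        rw [← Real.exp_add]; ring_nf
      rw [e1, e2, e3]
      nlinarith [sq_nonneg (Real.exp (p / 2) - Real.exp (q / 2))]
    refine le_trans (le_of_eq ?_) ((hconv (A t + (2 * ∫ z', f t z' ∂μ - 2 * ∫ z', g t z' ∂μ))
      (a z t - 2 * f t z)).trans ?_)
    · simp only [ha]
      ring_nf
    · gcongr
      exact le_expMax ht fun t => a z t - 2 * f t z
  have hm1 : Measurable fun z => expMax G (fun t => a z t + 2 * f t z) :=
    measurable_expMax G fun t =>
      (((hgm t).const_mul 2).const_sub (A t)).add ((hfm t).const_mul 2)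
  have hm2 : Measurable fun z => expMax G (fun t => a z t - 2 * f t z) :=
    measurable_expMax G fun t =>
      (((hgm t).const_mul 2).const_sub (A t)).sub ((hfm t).const_mul 2)
  calc _ ≤ ∫⁻ z, 2⁻¹ * (I + expMax G (fun t => a z t - 2 * f t z)) ∂μ := lintegral_mono key
    _ = ∫⁻ z, 2⁻¹ * (expMax G (fun t => a z t + 2 * f t z) +
          expMax G (fun t => a z t - 2 * f t z)) ∂μ := by
        have hm3 : Measurable fun z => expMax G (fun t => a z t + 2 * f t z) +
          expMax G (fun t => a z t - 2 * f t z) := hm1.add hm2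
        rw [lintegral_const_mul _ (hm2.const_add _), lintegral_const_mul _ hm3,
          lintegral_add_left measurable_const, lintegral_add_left hm1]
        simp [hI]
    _ ≤ _ := by
        refine lintegral_mono fun z => ?_
        rw [Fintype.sum_bool]
        gcongr 2⁻¹ * ?_
        refine (expMax_contraction G (a := a z) (f := fun t => 2 * f t z) (h := fun t => 2 * h t z)
          (fun t _ => ?_) fun s _ t _ => ?_).trans (le_of_eq ?_)
        · rw [abs_mul, abs_mul]
          exact mul_le_mul_of_nonneg_left (hf t z) (abs_nonneg _)
        · rw [← mul_sub, ← mul_sub, abs_mul, abs_mul]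
          exact mul_le_mul_of_nonneg_left (hfh s t z) (abs_nonneg _)
        · simp only [ha, boolSign, if_true, Bool.false_eq_true, if_false]
          congr 2 <;> ext t <;> ring

/-- Tensorization of a one-coordinate comparison of exponential maxima. -/
theorem lintegral_expMax_pi_le (G : Finset ι) {X : ι → Z → ℝ} {Y : ι → Bool → Z → ℝ}
    (hX : ∀ t, Measurable (X t)) (hY : ∀ t b, Measurable (Y t b))
    (H : ∀ A : ι → ℝ, ∫⁻ z, expMax G (fun t => A t + X t z) ∂μ ≤
      ∫⁻ z, 2⁻¹ * ∑ b : Bool, expMax G (fun t => A t + Y t b z) ∂μ) (n : ℕ) :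
    ∀ A : ι → ℝ,
      ∫⁻ z, expMax G (fun t => A t + ∑ i, X t (z i)) ∂(Measure.pi fun _ : Fin n => μ) ≤
        ∫⁻ z, 2⁻¹ ^ n * ∑ σ : Fin n → Bool, expMax G (fun t => A t + ∑ i, Y t (σ i) (z i))
          ∂(Measure.pi fun _ : Fin n => μ) := by
  induction n with
  | zero => intro A; simp
  | succ n ih =>
    intro A
    have hmp := (measurePreserving_piFinSuccAbove (fun _ : Fin (n + 1) => μ) 0).symm
    have hXm : ∀ m (B : ι → ℝ), Measurable fun z : Fin m → Z =>
        expMax G (fun t => B t + ∑ i, X t (z i)) := fun m B =>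
      measurable_expMax G fun t => (Finset.measurable_fun_sum _ fun i _ =>
        (hX t).comp (measurable_pi_apply i)).const_add _
    have hYm : ∀ m (B : ι → ℝ) (σ : Fin m → Bool), Measurable fun z : Fin m → Z =>
        expMax G (fun t => B t + ∑ i, Y t (σ i) (z i)) := fun m B σ =>
      measurable_expMax G fun t => (Finset.measurable_fun_sum _ fun i _ =>
        (hY t (σ i)).comp (measurable_pi_apply i)).const_add _
    have hYm' : ∀ m (B : ι → ℝ), Measurable fun z : Fin m → Z =>
        2⁻¹ ^ m * ∑ σ : Fin m → Bool, expMax G (fun t => B t + ∑ i, Y t (σ i) (z i)) := fun m B =>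
      (Finset.measurable_fun_sum _ fun σ _ => hYm m B σ).const_mul _
    have hjXY : ∀ σ : Fin n → Bool, Measurable fun p : Z × (Fin n → Z) =>
        expMax G (fun t => A t + X t p.1 + ∑ i, Y t (σ i) (p.2 i)) := fun σ =>
      measurable_expMax G fun t => (((hX t).comp measurable_fst).const_add _).add
        (Finset.measurable_fun_sum _ fun i _ =>
          (hY t (σ i)).comp ((measurable_pi_apply i).comp measurable_snd))
    have hjY : ∀ (b : Bool) (σ : Fin n → Bool), Measurable fun p : Z × (Fin n → Z) =>
        expMax G (fun t => A t + ∑ i, Y t (σ i) (p.2 i) + Y t b p.1) := fun b σ =>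
      measurable_expMax G fun t => ((Finset.measurable_fun_sum _ fun i _ =>
          (hY t (σ i)).comp ((measurable_pi_apply i).comp measurable_snd)).const_add _).add
          ((hY t b).comp measurable_fst)
    have hcons : ∀ (a : Z) (z : Fin n → Z),
        (MeasurableEquiv.piFinSuccAbove (fun _ : Fin (n + 1) => Z) 0).symm (a, z) = Fin.cons a z := by
      intro a z
      ext i
      refine Fin.cases ?_ (fun j => ?_) i <;> simp [MeasurableEquiv.piFinSuccAbove]
    have hsum : ∀ F : (Fin (n + 1) → Bool) → ENNReal,
        ∑ σ, F σ = ∑ b : Bool, ∑ σ : Fin n → Bool, F (Fin.cons b σ) := by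
      intro F
      rw [← (Fin.consEquiv fun _ : Fin (n + 1) => Bool).sum_comp, Fintype.sum_prod_type]
      rfl
    have eX := lintegral_prod (μ := μ) (ν := Measure.pi fun _ : Fin n => μ) _
      ((hXm _ A).comp hmp.measurable).aemeasurable
    have eY := lintegral_prod_symm (μ := μ) (ν := Measure.pi fun _ : Fin n => μ) _
      ((hYm' _ A).comp hmp.measurable).aemeasurable
    simp only [Function.comp_def] at eX eY
    rw [← hmp.lintegral_comp (hXm _ A), ← hmp.lintegral_comp (hYm' _ A), eX, eY]
    simp only [hcons, hsum, Fin.sum_univ_succ, Fin.cons_zero, Fin.cons_succ]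
    -- The arbitrary offset drives the induction: it first absorbs the coordinate `a` while the
    -- other `n` are compared, then those `n` while `H` is applied to `a`.
    calc ∫⁻ a, ∫⁻ z, expMax G (fun t => A t + (X t a + ∑ i, X t (z i)))
          ∂(Measure.pi fun _ : Fin n => μ) ∂μ
        ≤ ∫⁻ a, ∫⁻ z, 2⁻¹ ^ n * ∑ σ : Fin n → Bool,
            expMax G (fun t => A t + X t a + ∑ i, Y t (σ i) (z i))
            ∂(Measure.pi fun _ : Fin n => μ) ∂μ := by
          refine lintegral_mono fun a => ?_
          simp only [← add_assoc]
          exact ih fun t => A t + X t a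
      _ = ∫⁻ z, ∫⁻ a, 2⁻¹ ^ n * ∑ σ : Fin n → Bool,
            expMax G (fun t => A t + X t a + ∑ i, Y t (σ i) (z i))
            ∂μ ∂(Measure.pi fun _ : Fin n => μ) :=
          lintegral_lintegral_swap
            ((Finset.measurable_fun_sum _ fun σ _ => hjXY σ).const_mul _).aemeasurable
      _ ≤ _ := by
          refine lintegral_mono fun z => ?_
          have m1 : ∀ σ : Fin n → Bool, Measurable fun a : Z =>
              expMax G (fun t => A t + X t a + ∑ i, Y t (σ i) (z i)) := fun σ =>
            measurable_expMax G fun t => ((hX t).const_add _).add_const _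
          have m2 : ∀ (b : Bool) (σ : Fin n → Bool), Measurable fun a : Z =>
              expMax G (fun t => A t + ∑ i, Y t (σ i) (z i) + Y t b a) := fun b σ =>
            measurable_expMax G fun t => (hY t b).const_add _
          have m3 : ∀ σ : Fin n → Bool, Measurable fun a : Z => 2⁻¹ * ∑ b : Bool,
              expMax G (fun t => A t + ∑ i, Y t (σ i) (z i) + Y t b a) := fun σ =>
            (Finset.measurable_fun_sum _ fun b _ => m2 b σ).const_mul _
          rw [lintegral_const_mul _ (Finset.measurable_fun_sum _ fun σ _ => m1 σ),
            lintegral_finsetSum _ fun σ _ => m1 σ]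
          calc _ ≤ 2⁻¹ ^ n * ∑ σ : Fin n → Bool, ∫⁻ a, 2⁻¹ * ∑ b : Bool,
                expMax G (fun t => A t + ∑ i, Y t (σ i) (z i) + Y t b a) ∂μ := by
                gcongr 2⁻¹ ^ n * ∑ σ : Fin n → Bool, ?_ with σ
                refine le_trans (le_of_eq ?_) (H fun t => A t + ∑ i, Y t (σ i) (z i))
                refine lintegral_congr fun a => ?_
                congr 1
                ext t
                ring
            _ = 2⁻¹ ^ n * ∫⁻ a, ∑ σ : Fin n → Bool, 2⁻¹ * ∑ b : Bool,
                expMax G (fun t => A t + ∑ i, Y t (σ i) (z i) + Y t b a) ∂μ := by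
                rw [lintegral_finsetSum _ fun σ _ => m3 σ]
            _ = ∫⁻ a, 2⁻¹ ^ n * ∑ σ : Fin n → Bool, 2⁻¹ * ∑ b : Bool,
                expMax G (fun t => A t + ∑ i, Y t (σ i) (z i) + Y t b a) ∂μ := by
                rw [lintegral_const_mul _ (Finset.measurable_fun_sum _ fun σ _ => m3 σ)]
            _ = _ := by
                refine lintegral_congr fun a => ?_
                rw [← Finset.mul_sum, ← mul_assoc, ← pow_succ, Finset.sum_comm]
                congr 1
                refine Finset.sum_congr rfl fun b _ => Finset.sum_congr rfl fun σ _ => ?_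
                congr 1
                ext t
                ring

end ExpMax

/-! ### Exponential moments of random signs over a subspace. -/

section SignedSums

theorem rademacher_mgf {n : ℕ} (a : Fin n → ℝ) :
    2⁻¹ ^ n * ∑ σ : Fin n → Bool, Real.exp (∑ i, boolSign (σ i) * a i) =
      ∏ i, Real.cosh (a i) := by
  have h1 : ∀ i, Real.cosh (a i) = 2⁻¹ * ∑ b : Bool, Real.exp (boolSign b * a i) := by
    intro i
    rw [Real.cosh_eq, Fintype.sum_bool]
    simp [boolSign]
    ring
  simp_rw [h1, Finset.prod_mul_distrib, Finset.prod_univ_sum, Fintype.piFinset_univ,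
    Real.exp_sum, Finset.prod_const, Finset.card_univ, Fintype.card_fin]

theorem integrable_exp_sq_div_four_gaussianReal :
    Integrable (fun x : ℝ => Real.exp (x ^ 2 / 4)) (gaussianReal 0 1) := by
  rw [gaussianReal_of_var_ne_zero _ one_ne_zero, integrable_withDensity_iff_integrable_smul₀'
    (measurable_gaussianPDF 0 1).aemeasurable (by simp [gaussianPDF])]
  have : (fun x : ℝ => (gaussianPDF 0 1 x).toReal • Real.exp (x ^ 2 / 4)) =
      fun x => (√(2 * Real.pi))⁻¹ * Real.exp (-(1 / 4) * x ^ 2) := by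
    ext x
    rw [toReal_gaussianPDF, gaussianPDFReal, smul_eq_mul, mul_assoc, ← Real.exp_add]
    simp only [NNReal.coe_one, mul_one]
    ring_nf
  rw [this]
  exact (integrable_exp_neg_mul_sq (by norm_num)).const_mul _

/-- The value `E exp (Z² / 4)` for a standard normal variable `Z`. -/
noncomputable def gaussianExpSq : ℝ := ∫ x, Real.exp (x ^ 2 / 4) ∂(gaussianReal 0 1)

theorem one_le_gaussianExpSq : 1 ≤ gaussianExpSq := by
  have : ∫ _x : ℝ, (1 : ℝ) ∂(gaussianReal 0 1) ≤ gaussianExpSq :=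
    integral_mono (integrable_const _) integrable_exp_sq_div_four_gaussianReal
      fun x => Real.one_le_exp (by positivity)
  simpa using this

theorem integral_exp_mul_gaussianReal (y : ℝ) :
    ∫ x, Real.exp (y * (√2 / 2) * x) ∂(gaussianReal 0 1) = Real.exp (y ^ 2 / 4) := by
  have h := congrFun (mgf_fun_id_gaussianReal (μ := 0) (v := 1)) (y * (√2 / 2))
  rw [mgf] at h
  rw [h]
  congr 1
  have : (√2) ^ 2 = 2 := Real.sq_sqrt two_pos.le
  simp
  nlinarith

/-- Exponential moment of the squared norm of the projection of a vector of random signs on an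
orthonormal family. -/
theorem rademacher_exp_sq_inner_le {n m : ℕ} {b : Fin m → EuclideanSpace ℝ (Fin n)}
    (hb : Orthonormal ℝ b) :
    2⁻¹ ^ n * ∑ σ : Fin n → Bool,
      Real.exp ((∑ j, (∑ i, boolSign (σ i) * b j i) ^ 2) / 4) ≤ gaussianExpSq ^ m := by
  set γ : Measure (Fin m → ℝ) := Measure.pi fun _ => gaussianReal 0 1
  have hint : ∀ σ : Fin n → Bool, Integrable (fun g : Fin m → ℝ =>
      ∏ j, Real.exp ((∑ i, boolSign (σ i) * b j i) * (√2 / 2) * g j)) γ := fun σ =>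
    Integrable.fintype_prod (μ := fun _ : Fin m => gaussianReal 0 1)
      (f := fun j x => Real.exp ((∑ i, boolSign (σ i) * b j i) * (√2 / 2) * x))
      fun j => integrable_exp_mul_gaussianReal _
  -- Gaussian linearization: each squared projection is replaced by a linear form in the signs,
  -- which then factorizes over the coordinates.
  have h1 : ∀ σ : Fin n → Bool,
      Real.exp ((∑ j, (∑ i, boolSign (σ i) * b j i) ^ 2) / 4) =
      ∫ g, ∏ j, Real.exp ((∑ i, boolSign (σ i) * b j i) * (√2 / 2) * g j) ∂γ := by
    intro σ
    rw [integral_fintype_prod_eq_prod (μ := fun _ : Fin m => gaussianReal 0 1)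
      (fun j x => Real.exp ((∑ i, boolSign (σ i) * b j i) * (√2 / 2) * x))]
    simp_rw [integral_exp_mul_gaussianReal]
    rw [← Real.exp_sum, Finset.sum_div]
  -- For fixed `g` the sign average is a product of hyperbolic cosines, bounded through `cosh x ≤
  -- exp (x² / 2)`. Orthonormality turns the resulting norm of `v` into that of `g`.
  have h2 : ∀ g : Fin m → ℝ, 2⁻¹ ^ n * ∑ σ : Fin n → Bool,
      ∏ j, Real.exp ((∑ i, boolSign (σ i) * b j i) * (√2 / 2) * g j) ≤
      ∏ j, Real.exp (g j ^ 2 / 4) := by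
    intro g
    set v : EuclideanSpace ℝ (Fin n) := ∑ j, g j • b j with hv
    have hvi : ∀ i, v i = ∑ j, g j * b j i := by
      intro i
      simp [hv]
    have hvn : ∑ i, v i ^ 2 = ∑ j, g j ^ 2 := by
      have e1 := hb.inner_sum g g Finset.univ
      rw [← hv, real_inner_self_eq_norm_sq, EuclideanSpace.real_norm_sq_eq] at e1
      simpa [sq] using e1
    have e2 : ∀ σ : Fin n → Bool,
        ∏ j, Real.exp ((∑ i, boolSign (σ i) * b j i) * (√2 / 2) * g j) =
        Real.exp (∑ i, boolSign (σ i) * ((√2 / 2) * v i)) := by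
      intro σ
      rw [← Real.exp_sum]
      congr 1
      simp_rw [hvi, Finset.mul_sum, Finset.sum_mul]
      rw [Finset.sum_comm]
      refine Finset.sum_congr rfl fun i _ => Finset.sum_congr rfl fun j _ => ?_
      ring
    simp_rw [e2]
    rw [rademacher_mgf, ← Real.exp_sum, ← Finset.sum_div, ← hvn, Finset.sum_div, Real.exp_sum]
    refine Finset.prod_le_prod (fun i _ => (Real.cosh_pos _).le) fun i _ => ?_
    refine (Real.cosh_le_exp_half_sq _).trans (le_of_eq ?_)
    congr 1
    have : (√2) ^ 2 = 2 := Real.sq_sqrt two_pos.le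
    rw [mul_pow, div_pow, this]
    ring
  calc _ = ∫ g, 2⁻¹ ^ n * ∑ σ : Fin n → Bool,
        ∏ j, Real.exp ((∑ i, boolSign (σ i) * b j i) * (√2 / 2) * g j) ∂γ := by
        rw [integral_const_mul, integral_finsetSum _ fun σ _ => hint σ]
        simp_rw [h1]
    _ ≤ ∫ g, ∏ j, Real.exp (g j ^ 2 / 4) ∂γ :=
        integral_mono ((integrable_finsetSum _ fun σ _ => hint σ).const_mul _)
          (Integrable.fintype_prod (μ := fun _ : Fin m => gaussianReal 0 1)
            (f := fun _ x => Real.exp (x ^ 2 / 4))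
            fun j => integrable_exp_sq_div_four_gaussianReal) h2
    _ = gaussianExpSq ^ m := by
        rw [integral_fintype_prod_eq_pow (fun x : ℝ => Real.exp (x ^ 2 / 4))]
        simp [gaussianExpSq]

/-- The offset Rademacher process over a subspace of dimension at most `m` has an exponential
moment that grows at most geometrically in `m`. -/
theorem rademacher_expMax_offset_le {ι : Type*} {n m : ℕ} (G : Finset ι)
    (W : Submodule ℝ (EuclideanSpace ℝ (Fin n))) (hW : Module.finrank ℝ W ≤ m)
    {w : ι → EuclideanSpace ℝ (Fin n)} (hw : ∀ t, w t ∈ W) :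
    2⁻¹ ^ n * ∑ σ : Fin n → Bool,
      expMax G (fun t => ∑ i, (2 * boolSign (σ i) * w t i - 2 * (2 * w t i ^ 2))) ≤
      ENNReal.ofReal (gaussianExpSq ^ m) := by
  set b := stdOrthonormalBasis ℝ W with hbdef
  set b' : Fin (Module.finrank ℝ W) → EuclideanSpace ℝ (Fin n) := fun j => (b j : _) with hb'
  have hb : Orthonormal ℝ b' := b.orthonormal.comp_linearIsometry W.subtypeₗᵢ
  have key : ∀ (σ : Fin n → Bool) (t : ι),
      ∑ i, (2 * boolSign (σ i) * w t i - 2 * (2 * w t i ^ 2)) ≤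
        (∑ j, (∑ i, boolSign (σ i) * b' j i) ^ 2) / 4 := by
    intro σ t
    set c : Fin (Module.finrank ℝ W) → ℝ := fun j => b.repr ⟨w t, hw t⟩ j with hc
    have hwt : w t = ∑ j, c j • b' j := by
      have := congrArg (Subtype.val) (b.sum_repr ⟨w t, hw t⟩)
      simpa using this.symm
    have hwi : ∀ i, w t i = ∑ j, c j * b' j i := by
      intro i
      rw [hwt]
      simp
    have hwn : ∑ i, w t i ^ 2 = ∑ j, c j ^ 2 := by
      have e1 := hb.inner_sum c c Finset.univ
      rw [← hwt, real_inner_self_eq_norm_sq, EuclideanSpace.real_norm_sq_eq] at e1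
      simpa [sq] using e1
    have hin : ∑ i, boolSign (σ i) * w t i = ∑ j, c j * ∑ i, boolSign (σ i) * b' j i := by
      simp_rw [hwi, Finset.mul_sum]
      rw [Finset.sum_comm]
      refine Finset.sum_congr rfl fun i _ => Finset.sum_congr rfl fun j _ => ?_
      ring
    calc _ = 2 * ∑ i, boolSign (σ i) * w t i - 4 * ∑ i, w t i ^ 2 := by
          rw [Finset.sum_sub_distrib, Finset.mul_sum, Finset.mul_sum]
          congr 1
          · exact Finset.sum_congr rfl fun i _ => by ring
          · exact Finset.sum_congr rfl fun i _ => by ring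
      _ = ∑ j, (2 * (c j * ∑ i, boolSign (σ i) * b' j i) - 4 * c j ^ 2) := by
          rw [hin, hwn, Finset.sum_sub_distrib, Finset.mul_sum, Finset.mul_sum]
      _ ≤ _ := by
          rw [Finset.sum_div]
          refine Finset.sum_le_sum fun j _ => ?_
          -- Completing the square removes the coefficients `c j`, so the bound no longer depends on
          -- `t`.
          nlinarith [sq_nonneg (4 * c j - ∑ i, boolSign (σ i) * b' j i)]
  calc _ ≤ 2⁻¹ ^ n * ∑ σ : Fin n → Bool,
        ENNReal.ofReal (Real.exp ((∑ j, (∑ i, boolSign (σ i) * b' j i) ^ 2) / 4)) := by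
        gcongr with σ
        exact expMax_le fun t _ => ENNReal.ofReal_le_ofReal (Real.exp_le_exp.2 (key σ t))
    _ = ENNReal.ofReal (2⁻¹ ^ n * ∑ σ : Fin n → Bool,
        Real.exp ((∑ j, (∑ i, boolSign (σ i) * b' j i) ^ 2) / 4)) := by
        rw [ENNReal.ofReal_mul (by positivity), ENNReal.ofReal_pow (by norm_num),
          ENNReal.ofReal_inv_of_pos two_pos,
          ENNReal.ofReal_sum_of_nonneg fun σ _ => (Real.exp_pos _).le]
        simp
    _ ≤ _ := ENNReal.ofReal_le_ofReal ((rademacher_exp_sq_inner_le hb).trans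
        (pow_le_pow_right₀ one_le_gaussianExpSq hW))

end SignedSums

/-! ### Uniform deviation inequality for the offset empirical process. -/

section Deviation

variable {ι Z : Type*} [MeasurableSpace Z] (μ : Measure Z) [IsProbabilityMeasure μ]

/-- The summand of the offset empirical process: `P f - f(z) - 2 P h² - 2 h(z)²`. -/
noncomputable def offsetTerm (f h : Z → ℝ) (z : Z) : ℝ :=
  ∫ z', f z' ∂μ - f z - ∫ z', 2 * h z' ^ 2 ∂μ - 2 * h z ^ 2

omit [IsProbabilityMeasure μ] in
theorem measurable_offsetTerm {f h : Z → ℝ} (hf : Measurable f) (hh : Measurable h) :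
    Measurable (offsetTerm μ f h) :=
  ((hf.const_sub _).sub_const _).sub ((hh.pow_const 2).const_mul 2)

variable {f h : ι → Z → ℝ} {B : ℝ}
  (hfm : ∀ t, Measurable (f t)) (hhm : ∀ t, Measurable (h t))
  (hfB : ∀ t z, |f t z| ≤ B) (hhB : ∀ t z, |h t z| ≤ B)
  (hf : ∀ t z, |f t z| ≤ |h t z|) (hfh : ∀ s t z, |f s z - f t z| ≤ |h s z - h t z|)
  (V : Submodule ℝ (Z → ℝ)) [FiniteDimensional ℝ V] {m : ℕ} (hV : Module.finrank ℝ V ≤ m)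
  (hhV : ∀ t, h t ∈ V)

include hfm hhm hfB hhB hf hfh hV hhV

theorem lintegral_expMax_offsetTerm_le (G : Finset ι) (n : ℕ) :
    ∫⁻ z, expMax G (fun t => ∑ i, offsetTerm μ (f t) (h t) (z i))
      ∂(Measure.pi fun _ : Fin n => μ) ≤ ENNReal.ofReal (gaussianExpSq ^ m) := by
  have h1 := lintegral_expMax_pi_le μ G (X := fun t => offsetTerm μ (f t) (h t))
    (Y := fun t b z => 2 * boolSign b * h t z - 2 * (2 * h t z ^ 2))
    (fun t => measurable_offsetTerm μ (hfm t) (hhm t))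
    (fun t b => ((hhm t).const_mul _).sub ((((hhm t).pow_const 2).const_mul 2).const_mul 2))
    (lintegral_expMax_offset_le μ G (g := fun t z => 2 * h t z ^ 2) (B := max B (2 * B ^ 2)) hfm
      (fun t => ((hhm t).pow_const 2).const_mul 2) (fun t z => le_max_of_le_left (hfB t z))
      (fun t z => le_max_of_le_right ?_) hf hfh) n fun _ => 0
  · simp only [zero_add] at h1
    refine h1.trans ?_
    calc _ ≤ ∫⁻ _, ENNReal.ofReal (gaussianExpSq ^ m) ∂(Measure.pi fun _ : Fin n => μ) := by
          refine lintegral_mono fun z => ?_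
          -- Evaluation at the sample points is linear, so the image of `V` has dimension at most
          -- `m` whatever the sample.
          set E : (Z → ℝ) →ₗ[ℝ] EuclideanSpace ℝ (Fin n) :=
            (WithLp.linearEquiv 2 ℝ (Fin n → ℝ)).symm.toLinearMap ∘ₗ LinearMap.funLeft ℝ ℝ z
          exact rademacher_expMax_offset_le G (V.map E) ((Submodule.finrank_map_le E V).trans hV)
            (w := fun t => E (h t)) fun t => Submodule.mem_map_of_mem (hhV t)
      _ = _ := by simp
  · have h2 := hhB t z
    rw [abs_mul, abs_two, abs_pow]
    gcongr

/-- An exponential deviation inequality, uniform over a countable class of functions that are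
dominated by a finite-dimensional one. -/
theorem measure_pi_offset_le [Countable ι] (n : ℕ) (s : ℝ) :
    (Measure.pi fun _ : Fin n => μ) {z | ∃ t, s < ∑ i, offsetTerm μ (f t) (h t) (z i)} ≤
      ENNReal.ofReal (Real.exp (-s) * gaussianExpSq ^ m) := by
  have hfin : ∀ G : Finset ι, (Measure.pi fun _ : Fin n => μ)
      {z | ∃ t ∈ G, s < ∑ i, offsetTerm μ (f t) (h t) (z i)} ≤
      ENNReal.ofReal (Real.exp (-s) * gaussianExpSq ^ m) := by
    intro G
    have hm : Measurable fun z : Fin n → Z =>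
        expMax G (fun t => ∑ i, offsetTerm μ (f t) (h t) (z i)) :=
      measurable_expMax G fun t => Finset.measurable_fun_sum _ fun i _ =>
        (measurable_offsetTerm μ (hfm t) (hhm t)).comp (measurable_pi_apply i)
    have h1 := (mul_meas_ge_le_lintegral (μ := Measure.pi fun _ : Fin n => μ) hm
      (ENNReal.ofReal (Real.exp s))).trans
      (lintegral_expMax_offsetTerm_le μ hfm hhm hfB hhB hf hfh V hV hhV G n)
    have h2 : {z : Fin n → Z | ∃ t ∈ G, s < ∑ i, offsetTerm μ (f t) (h t) (z i)} ⊆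
        {z | ENNReal.ofReal (Real.exp s) ≤
          expMax G (fun t => ∑ i, offsetTerm μ (f t) (h t) (z i))} := by
      rintro z ⟨t, ht, hst⟩
      exact (ENNReal.ofReal_le_ofReal (Real.exp_le_exp.2 hst.le)).trans (le_expMax ht _)
    refine (measure_mono h2).trans ?_
    rw [ENNReal.ofReal_mul (Real.exp_pos _).le, Real.exp_neg,
      ENNReal.ofReal_inv_of_pos (Real.exp_pos _), mul_comm, ← div_eq_mul_inv,
      ENNReal.le_div_iff_mul_le (Or.inl (by simp [Real.exp_pos])) (Or.inl ENNReal.ofReal_ne_top),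
      mul_comm]
    exact h1
  -- The finite bound does not depend on `G`, so it passes to the directed union over the countably
  -- many finite subfamilies.
  have hU : {z : Fin n → Z | ∃ t, s < ∑ i, offsetTerm μ (f t) (h t) (z i)} =
      ⋃ G : Finset ι, {z | ∃ t ∈ G, s < ∑ i, offsetTerm μ (f t) (h t) (z i)} := by
    ext z
    simp only [Set.mem_ofPred_eq, Set.mem_iUnion]
    exact ⟨fun ⟨t, ht⟩ => ⟨{t}, t, by simp, ht⟩, fun ⟨_, t, _, ht⟩ => ⟨t, ht⟩⟩
  classical
  rw [hU, Directed.measure_iUnion]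
  · exact iSup_le hfin
  · intro G₁ G₂
    exact ⟨G₁ ∪ G₂, fun z ⟨t, ht, h⟩ => ⟨t, Finset.mem_union_left _ ht, h⟩,
      fun z ⟨t, ht, h⟩ => ⟨t, Finset.mem_union_right _ ht, h⟩⟩

end Deviation

/-! ### Knight's identity and quadratic bounds for the expected check loss. -/

section CheckLoss

variable {τ : ℝ}

theorem measurable_checkLoss (τ : ℝ) : Measurable (checkLoss τ) := by
  unfold checkLoss
  exact (measurable_const.sub
    (Measurable.ite measurableSet_Iic measurable_const measurable_const)).mul measurable_id

theorem abs_checkLoss_sub_le (hτ : τ ∈ Set.Ioo (0 : ℝ) 1) (u v : ℝ) :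
    |checkLoss τ u - checkLoss τ v| ≤ |u - v| := by
  obtain ⟨h0, h1⟩ := hτ
  unfold checkLoss
  rcases abs_cases (u - v) with ⟨h, h'⟩ | ⟨h, h'⟩ <;> rw [h, abs_le] <;>
    split_ifs <;> constructor <;> nlinarith

/-- The nonnegative remainder in Knight's identity. -/
noncomputable def knightRem (τ v a : ℝ) : ℝ :=
  checkLoss τ (v - a) - checkLoss τ v + a * (τ - if v ≤ 0 then 1 else 0)

theorem knightRem_eq (τ v a : ℝ) : knightRem τ v a =
    (if 0 < v ∧ v ≤ a then a - v else 0) + (if a < v ∧ v ≤ 0 then v - a else 0) := by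
  unfold knightRem checkLoss
  split_ifs <;> first | ring1 | (exfalso; grind)

theorem knightRem_nonneg (τ v a : ℝ) : 0 ≤ knightRem τ v a := by
  rw [knightRem_eq]
  split_ifs <;> grind

theorem knightRem_le (τ v a : ℝ) :
    knightRem τ v a ≤ (Set.Ioc (-|a|) |a|).indicator (fun _ => |a|) v := by
  rw [knightRem_eq, Set.indicator_apply]
  simp only [Set.mem_Ioc]
  rcases abs_cases a with ⟨h, h'⟩ | ⟨h, h'⟩ <;> rw [h] <;> split_ifs <;> grind

theorem le_knightRem_of_nonneg (τ v : ℝ) {a r : ℝ} (hr : 2 * r ≤ a) (ha : 0 ≤ a) :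
    (Set.Ioc 0 r).indicator (fun _ => a / 2) v ≤ knightRem τ v a := by
  rw [knightRem_eq, Set.indicator_apply]
  simp only [Set.mem_Ioc]
  split_ifs <;> grind

theorem le_knightRem_of_nonpos (τ v : ℝ) {a r : ℝ} (hr : 2 * r < -a) (ha : a ≤ 0) :
    (Set.Ioc (-r) 0).indicator (fun _ => -a / 2) v ≤ knightRem τ v a := by
  rw [knightRem_eq, Set.indicator_apply]
  simp only [Set.mem_Ioc]
  split_ifs <;> grind

variable {κ : Measure ℝ} [IsProbabilityMeasure κ]

theorem integrable_checkLoss_sub (hτ : τ ∈ Set.Ioo (0 : ℝ) 1) (a : ℝ) :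
    Integrable (fun v => checkLoss τ (v - a) - checkLoss τ v) κ := by
  refine Integrable.of_bound (((measurable_checkLoss τ).comp (measurable_id.sub_const a)).sub
    (measurable_checkLoss τ)).aestronglyMeasurable |a| (Eventually.of_forall fun v => ?_)
  refine (abs_checkLoss_sub_le hτ _ _).trans (le_of_eq ?_)
  rw [show v - a - v = -a by ring, abs_neg]

theorem integrable_quantile_score (a : ℝ) :
    Integrable (fun v : ℝ => a * (τ - if v ≤ 0 then 1 else 0)) κ := by
  refine Integrable.const_mul ((integrable_const τ).sub ?_) a
  refine Integrable.of_bound (Measurable.ite measurableSet_Iic measurable_const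
    measurable_const).aestronglyMeasurable 1 (Eventually.of_forall fun v => ?_)
  split_ifs <;> simp

theorem integrable_knightRem (hτ : τ ∈ Set.Ioo (0 : ℝ) 1) (a : ℝ) :
    Integrable (fun v => knightRem τ v a) κ :=
  (integrable_checkLoss_sub hτ a).add (integrable_quantile_score a)

/-- The linear term of Knight's identity has mean zero because `κ` gives mass `τ` to `(-∞, 0]`. -/
theorem integral_checkLoss_sub_eq (hτ : τ ∈ Set.Ioo (0 : ℝ) 1)
    (hq : κ (Set.Iic 0) = ENNReal.ofReal τ) (a : ℝ) :
    ∫ v, (checkLoss τ (v - a) - checkLoss τ v) ∂κ = ∫ v, knightRem τ v a ∂κ := by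
  unfold knightRem
  rw [integral_add (integrable_checkLoss_sub hτ a) (integrable_quantile_score a),
    integral_const_mul]
  have h1 : ∫ v : ℝ, (if v ≤ 0 then (1 : ℝ) else 0) ∂κ = τ := by
    have : (fun v : ℝ => if v ≤ 0 then (1 : ℝ) else 0) = (Set.Iic (0 : ℝ)).indicator 1 := by
      ext v
      simp [Set.indicator_apply]
    rw [this, integral_indicator_one measurableSet_Iic, measureReal_def, hq,
      ENNReal.toReal_ofReal hτ.1.le]
  have h2 : Integrable (fun v : ℝ => if v ≤ 0 then (1 : ℝ) else 0) κ :=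
    Integrable.of_bound (Measurable.ite measurableSet_Iic measurable_const
      measurable_const).aestronglyMeasurable 1
      (Eventually.of_forall fun v => by split_ifs <;> simp)
  rw [integral_sub (integrable_const _) h2, h1]
  simp

variable {p : ℝ → ℝ}

theorem le_measureReal_Ioc (hp : κ = volume.withDensity fun v => ENNReal.ofReal (p v)) {c a b : ℝ}
    (hc : 0 ≤ c) (h : ∀ v ∈ Set.Ioc a b, c ≤ p v) :
    c * (b - a) ≤ κ.real (Set.Ioc a b) := by
  have h1 : ENNReal.ofReal (c * (b - a)) ≤ κ (Set.Ioc a b) := by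
    conv_rhs => rw [hp]
    rw [withDensity_apply _ measurableSet_Ioc, ENNReal.ofReal_mul hc, ← Real.volume_Ioc,
      ← setLIntegral_const]
    exact setLIntegral_mono' measurableSet_Ioc fun v hv => ENNReal.ofReal_le_ofReal (h v hv)
  rw [measureReal_def]
  exact (ENNReal.ofReal_le_iff_le_toReal (measure_ne_top _ _)).1 h1

omit [IsProbabilityMeasure κ] in
theorem measureReal_Ioc_le (hp : κ = volume.withDensity fun v => ENNReal.ofReal (p v)) {c a b : ℝ}
    (hc : 0 ≤ c) (hab : a ≤ b) (h : ∀ v ∈ Set.Ioc a b, p v ≤ c) :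
    κ.real (Set.Ioc a b) ≤ c * (b - a) := by
  have h1 : κ (Set.Ioc a b) ≤ ENNReal.ofReal (c * (b - a)) := by
    conv_lhs => rw [hp]
    rw [withDensity_apply _ measurableSet_Ioc, ENNReal.ofReal_mul hc, ← Real.volume_Ioc,
      ← setLIntegral_const]
    exact setLIntegral_mono' measurableSet_Ioc fun v hv => ENNReal.ofReal_le_ofReal (h v hv)
  rw [measureReal_def]
  exact ENNReal.toReal_le_of_le_ofReal (mul_nonneg hc (sub_nonneg.2 hab)) h1

/-- On an interval of length `r`, next to `0` on the side of `a`, the Knight remainder is at least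
`|a| / 2`. The density is controlled only within `δ` of `0`, so growth is merely linear for large
`|a|`; the factor `min 1 (δ / B)` converts this into a quadratic bound on `|a| ≤ B`. -/
theorem mul_sq_le_integral_checkLoss_sub (hτ : τ ∈ Set.Ioo (0 : ℝ) 1)
    (hq : κ (Set.Iic 0) = ENNReal.ofReal τ)
    (hp : κ = volume.withDensity fun v => ENNReal.ofReal (p v)) {c δ B : ℝ} (hc : 0 ≤ c)
    (hδ : 0 < δ) (hB : 0 < B) (h : ∀ v, |v| < δ → c ≤ p v) {a : ℝ} (ha : |a| ≤ B) :
    c / 8 * min 1 (δ / B) * a ^ 2 ≤ ∫ v, (checkLoss τ (v - a) - checkLoss τ v) ∂κ := by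
  rw [integral_checkLoss_sub_eq hτ hq]
  -- The divisor `4` leaves room for the strict inequalities `r < δ` and, when `a ≠ 0`, `2 * r <
  -- |a|`.
  set r := min |a| δ / 4 with hr
  have hr0 : 0 ≤ r := by positivity
  have hra : 4 * r ≤ |a| := by
    have := min_le_left |a| δ
    linarith
  have hrδ : r < δ := by
    have := min_le_right |a| δ
    linarith
  have hrl : |a| * min 1 (δ / B) ≤ 4 * r := by
    have h0 : 4 * r = min |a| δ := by rw [hr]; ring
    rw [h0]
    refine le_min (mul_le_of_le_one_right (abs_nonneg _) (min_le_left _ _)) ?_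
    calc |a| * min 1 (δ / B) ≤ B * (δ / B) :=
          mul_le_mul ha (min_le_right _ _) (by positivity) hB.le
      _ = δ := by field_simp
  have hfin : c / 8 * min 1 (δ / B) * a ^ 2 ≤ |a| / 2 * (c * r) := by
    rw [← sq_abs a]
    have : 0 ≤ c * |a| := by positivity
    nlinarith [mul_le_mul_of_nonneg_left hrl this]
  refine hfin.trans ?_
  rcases eq_or_ne a 0 with rfl | ha0
  · simpa using integral_nonneg fun v => knightRem_nonneg τ v 0
  rcases le_total 0 a with h0 | h0
  · rw [abs_of_nonneg h0] at hra ⊢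
    calc a / 2 * (c * r) ≤ a / 2 * κ.real (Set.Ioc 0 r) := by
          gcongr
          have := le_measureReal_Ioc (a := 0) hp hc fun v hv => h v (by
            rw [abs_of_pos hv.1]; exact hv.2.trans_lt hrδ)
          simpa using this
      _ = ∫ v, (Set.Ioc 0 r).indicator (fun _ => a / 2) v ∂κ := by
          rw [integral_indicator_const _ measurableSet_Ioc, smul_eq_mul, mul_comm]
      _ ≤ _ := integral_mono ((integrable_const _).indicator measurableSet_Ioc)
          (integrable_knightRem hτ a) fun v => le_knightRem_of_nonneg τ v (by linarith) h0
  · have habs : |a| = -a := abs_of_nonpos h0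
    have hlt : a < 0 := lt_of_le_of_ne h0 ha0
    rw [habs] at hra ⊢
    calc -a / 2 * (c * r) ≤ -a / 2 * κ.real (Set.Ioc (-r) 0) := by
          have := le_measureReal_Ioc (a := -r) (b := 0) hp hc fun v hv => h v (by
            rw [abs_of_nonpos hv.2]; linarith [hv.1])
          rw [zero_sub, neg_neg] at this
          exact mul_le_mul_of_nonneg_left this (by linarith)
      _ = ∫ v, (Set.Ioc (-r) 0).indicator (fun _ => -a / 2) v ∂κ := by
          rw [integral_indicator_const _ measurableSet_Ioc, smul_eq_mul, mul_comm]
      _ ≤ _ := integral_mono ((integrable_const _).indicator measurableSet_Ioc)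
          (integrable_knightRem hτ a) fun v => le_knightRem_of_nonpos τ v (by
            linarith) h0

theorem integral_checkLoss_sub_le (hτ : τ ∈ Set.Ioo (0 : ℝ) 1)
    (hq : κ (Set.Iic 0) = ENNReal.ofReal τ)
    (hp : κ = volume.withDensity fun v => ENNReal.ofReal (p v)) {c δ : ℝ} (hc : 0 ≤ c)
    (h : ∀ v, |v| < δ → p v ≤ c) {a : ℝ} (ha : |a| < δ) :
    ∫ v, (checkLoss τ (v - a) - checkLoss τ v) ∂κ ≤ 2 * c * a ^ 2 := by
  rw [integral_checkLoss_sub_eq hτ hq]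
  calc ∫ v, knightRem τ v a ∂κ ≤ ∫ v, (Set.Ioc (-|a|) |a|).indicator (fun _ => |a|) v ∂κ :=
        integral_mono (integrable_knightRem hτ a)
          ((integrable_const _).indicator measurableSet_Ioc) fun v => knightRem_le τ v a
    _ = |a| * κ.real (Set.Ioc (-|a|) |a|) := by
        rw [integral_indicator_const _ measurableSet_Ioc, smul_eq_mul, mul_comm]
    _ ≤ |a| * (c * (|a| - -|a|)) := by
        gcongr
        exact measureReal_Ioc_le hp hc (by linarith [abs_nonneg a]) fun v hv =>
          h v ((abs_le.2 ⟨hv.1.le, hv.2⟩).trans_lt ha)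
    _ = _ := by rw [← sq_abs a]; ring

end CheckLoss

/-! ### Excess risk: offset deviations and the oracle inequality. -/

section ExcessLoss

variable {τ : ℝ}

theorem continuous_checkLoss (hτ : τ ∈ Set.Ioo (0 : ℝ) 1) : Continuous (checkLoss τ) :=
  (LipschitzWith.of_dist_le_mul (K := 1) fun u v => by
    simpa [Real.dist_eq] using abs_checkLoss_sub_le hτ u v).continuous

variable {S : Type*} [MeasurableSpace S]

/-- The loss of `θ` in excess of that of `θ'`, at a point `x` and an error `v`, when the true
quantile function is `θ₀`. -/
noncomputable def excessLoss (τ : ℝ) (θ₀ θ' θ : S → ℝ) (p : S × ℝ) : ℝ :=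
  checkLoss τ (p.2 - (θ p.1 - θ₀ p.1)) - checkLoss τ (p.2 - (θ' p.1 - θ₀ p.1))

theorem measurable_excessLoss {θ₀ θ' θ : S → ℝ} (h₀ : Measurable θ₀) (h' : Measurable θ')
    (h : Measurable θ) : Measurable (excessLoss τ θ₀ θ' θ) :=
  ((measurable_checkLoss τ).comp (measurable_snd.sub ((h.sub h₀).comp measurable_fst))).sub
    ((measurable_checkLoss τ).comp (measurable_snd.sub ((h'.sub h₀).comp measurable_fst)))

omit [MeasurableSpace S] in
theorem abs_excessLoss_sub_le (hτ : τ ∈ Set.Ioo (0 : ℝ) 1) (θ₀ θ' θ₁ θ₂ : S → ℝ) (p : S × ℝ) :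
    |excessLoss τ θ₀ θ' θ₁ p - excessLoss τ θ₀ θ' θ₂ p| ≤ |θ₁ p.1 - θ₂ p.1| := by
  have h := abs_checkLoss_sub_le hτ (p.2 - (θ₁ p.1 - θ₀ p.1)) (p.2 - (θ₂ p.1 - θ₀ p.1))
  rw [show p.2 - (θ₁ p.1 - θ₀ p.1) - (p.2 - (θ₂ p.1 - θ₀ p.1)) = -(θ₁ p.1 - θ₂ p.1) by ring,
    abs_neg] at h
  unfold excessLoss
  rwa [sub_sub_sub_cancel_right]

omit [MeasurableSpace S] in
theorem excessLoss_self (θ₀ θ : S → ℝ) (p : S × ℝ) : excessLoss τ θ₀ θ θ p = 0 := by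
  simp [excessLoss]

omit [MeasurableSpace S] in
theorem abs_excessLoss_le (hτ : τ ∈ Set.Ioo (0 : ℝ) 1) (θ₀ θ' θ : S → ℝ) (p : S × ℝ) :
    |excessLoss τ θ₀ θ' θ p| ≤ |θ p.1 - θ' p.1| := by
  simpa [excessLoss_self] using abs_excessLoss_sub_le hτ θ₀ θ' θ θ' p

variable (ν : Measure S) [IsProbabilityMeasure ν] (κ : Kernel S ℝ) [IsMarkovKernel κ]

theorem integrable_excessLoss (hτ : τ ∈ Set.Ioo (0 : ℝ) 1) {θ₀ θ' θ : S → ℝ} {B : ℝ}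
    (h₀ : Measurable θ₀) (h' : Measurable θ') (h : Measurable θ)
    (hB : ∀ x, |θ x - θ' x| ≤ B) : Integrable (excessLoss τ θ₀ θ' θ) (ν ⊗ₘ κ) :=
  Integrable.of_bound (measurable_excessLoss h₀ h' h).aestronglyMeasurable B
    (Eventually.of_forall fun p => (abs_excessLoss_le hτ θ₀ θ' θ p).trans (hB p.1))

omit [MeasurableSpace S] in
theorem excessLoss_self_left (θ₀ θ : S → ℝ) (x : S) (v : ℝ) :
    excessLoss τ θ₀ θ₀ θ (x, v) = checkLoss τ (v - (θ x - θ₀ x)) - checkLoss τ v := by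
  simp [excessLoss]

theorem mul_integral_sq_le_integral_excessLoss (hτ : τ ∈ Set.Ioo (0 : ℝ) 1) {θ₀ θ : S → ℝ}
    {B c : ℝ} (h₀ : Measurable θ₀) (h : Measurable θ) (hB : ∀ x, |θ x - θ₀ x| ≤ B)
    (hc : ∀ x a, |a| ≤ B → c * a ^ 2 ≤ ∫ v, (checkLoss τ (v - a) - checkLoss τ v) ∂(κ x)) :
    c * ∫ x, (θ x - θ₀ x) ^ 2 ∂ν ≤ ∫ p, excessLoss τ θ₀ θ₀ θ p ∂(ν ⊗ₘ κ) := by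
  have hi := integrable_excessLoss ν κ hτ h₀ h₀ h hB
  rw [Measure.integral_compProd hi, ← integral_const_mul]
  refine integral_mono ?_ hi.integral_compProd fun x => ?_
  · refine Integrable.const_mul (Integrable.of_bound
      ((h.sub h₀).pow_const 2).aestronglyMeasurable (B ^ 2) (Eventually.of_forall fun x => ?_)) c
    rw [Real.norm_eq_abs, abs_pow]
    exact pow_le_pow_left₀ (abs_nonneg _) (hB x) 2
  · simp_rw [excessLoss_self_left]
    exact hc x _ (hB x)

theorem integral_excessLoss_le (hτ : τ ∈ Set.Ioo (0 : ℝ) 1) {θ₀ θ : S → ℝ}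
    {η c : ℝ} (hc0 : 0 ≤ c) (h₀ : Measurable θ₀) (h : Measurable θ) (hη : ∀ x, |θ x - θ₀ x| ≤ η)
    (hc : ∀ x a, |a| ≤ η → ∫ v, (checkLoss τ (v - a) - checkLoss τ v) ∂(κ x) ≤ c * a ^ 2) :
    ∫ p, excessLoss τ θ₀ θ₀ θ p ∂(ν ⊗ₘ κ) ≤ c * η ^ 2 := by
  have hi := integrable_excessLoss ν κ hτ h₀ h₀ h hη
  rw [Measure.integral_compProd hi]
  calc _ ≤ ∫ _, c * η ^ 2 ∂ν := by
        refine integral_mono hi.integral_compProd (integrable_const _) fun x => ?_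
        simp_rw [excessLoss_self_left]
        refine (hc x _ (hη x)).trans ?_
        rw [← sq_abs (θ x - θ₀ x)]
        exact mul_le_mul_of_nonneg_left (pow_le_pow_left₀ (abs_nonneg _) (hη x) 2) hc0
    _ = _ := by simp

variable [TopologicalSpace S] [BorelSpace S]

/-- The offset excess risk of `θ` over the sample point `p`. -/
noncomputable def offsetExcess (τ c : ℝ) (θ₀ θ' θ : S → ℝ) (p : S × ℝ) : ℝ :=
  ∫ q, excessLoss τ θ₀ θ' θ q ∂(ν ⊗ₘ κ) - excessLoss τ θ₀ θ' θ p -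
    2 * c * ∫ x, (θ x - θ' x) ^ 2 ∂ν

omit [IsProbabilityMeasure ν] [BorelSpace S] in
theorem integrable_sub_sq [IsFiniteMeasure ν] [OpensMeasurableSpace S] {B : ℝ} (θ' θ : C(S, ℝ))
    (hB : ∀ x, |θ x - θ' x| ≤ B) : Integrable (fun x => (θ x - θ' x) ^ 2) ν := by
  refine Integrable.of_bound ((θ.continuous.measurable.sub
    θ'.continuous.measurable).pow_const 2).aestronglyMeasurable (B ^ 2)
    (Eventually.of_forall fun x => ?_)
  rw [Real.norm_eq_abs, abs_pow]
  exact pow_le_pow_left₀ (abs_nonneg _) (hB x) 2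

/-- Subtracting `c (θ - θ')²` from the loss is designed so that the empirical square cancels `2
h(p)²`; the relation `2 l L² = c` is exactly this cancellation. Only a population penalty remains.
-/
theorem offsetTerm_eq_mul_offsetExcess (hτ : τ ∈ Set.Ioo (0 : ℝ) 1) {B c L l : ℝ}
    (hl : 2 * l * L ^ 2 = c) (θ₀ θ' θ : C(S, ℝ)) (hB : ∀ x, |θ x - θ' x| ≤ B) (p : S × ℝ) :
    offsetTerm (ν ⊗ₘ κ) (fun q => l * (excessLoss τ θ₀ θ' θ q - c * (θ q.1 - θ' q.1) ^ 2))
      (fun q => l * L * (θ q.1 - θ' q.1)) p = l * offsetExcess ν κ τ c θ₀ θ' θ p := by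
  have h1 : ∫ q, (θ q.1 - θ' q.1) ^ 2 ∂(ν ⊗ₘ κ) = ∫ x, (θ x - θ' x) ^ 2 ∂ν := by
    conv_rhs => rw [← Measure.fst_compProd ν κ, Measure.fst]
    rw [integral_map measurable_fst.aemeasurable]
    exact ((θ.continuous.measurable.sub
      θ'.continuous.measurable).pow_const 2).aestronglyMeasurable
  have h2 : Integrable (fun q : S × ℝ => (θ q.1 - θ' q.1) ^ 2) (ν ⊗ₘ κ) := by
    refine Integrable.of_bound (((θ.continuous.measurable.sub
      θ'.continuous.measurable).pow_const 2).comp measurable_fst).aestronglyMeasurable (B ^ 2)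
      (Eventually.of_forall fun q => ?_)
    rw [Real.norm_eq_abs, abs_pow]
    exact pow_le_pow_left₀ (abs_nonneg _) (hB q.1) 2
  have h3 := integrable_excessLoss ν κ hτ θ₀.continuous.measurable θ'.continuous.measurable
    θ.continuous.measurable hB
  unfold offsetTerm offsetExcess
  simp_rw [mul_pow, ← mul_assoc]
  rw [integral_const_mul, integral_const_mul, integral_sub h3 (h2.const_mul c),
    integral_const_mul, h1, ← hl]
  ring

/-- Reduces the supremum over the sieve to a countable dense subset. -/
theorem continuous_offsetExcess [CompactSpace S] (hτ : τ ∈ Set.Ioo (0 : ℝ) 1) {B c : ℝ}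
    (θ₀ θ' : C(S, ℝ))
    {A : Set C(S, ℝ)} (hB : ∀ θ ∈ A, ∀ x, |θ x - θ' x| ≤ B)
    (p : S × ℝ) : Continuous fun θ : A => offsetExcess ν κ τ c θ₀ θ' (θ : C(S, ℝ)) p := by
  have hev : ∀ x : S, Continuous fun θ : A => (θ : C(S, ℝ)) x := fun x =>
    (continuous_eval_const x).comp continuous_subtype_val
  have hex : ∀ q : S × ℝ, Continuous fun θ : A => excessLoss τ θ₀ θ' (θ : C(S, ℝ)) q := fun q =>
    ((continuous_checkLoss hτ).comp
      (continuous_const.sub ((hev q.1).sub continuous_const))).sub continuous_const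
  refine ((continuous_of_dominated (bound := fun _ => B) (fun θ => ?_) (fun θ => ?_)
    (integrable_const _) (Eventually.of_forall hex)).sub (hex p)).sub
    (continuous_const.mul (continuous_of_dominated (bound := fun _ => B ^ 2) (fun θ => ?_)
      (fun θ => ?_) (integrable_const _) (Eventually.of_forall fun x =>
        ((hev x).sub continuous_const).pow 2)))
  · exact (measurable_excessLoss θ₀.continuous.measurable θ'.continuous.measurable
      (θ : C(S, ℝ)).continuous.measurable).aestronglyMeasurable
  · exact Eventually.of_forall fun q => (abs_excessLoss_le hτ θ₀ θ' _ q).trans (hB θ θ.2 q.1)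
  · exact (((θ : C(S, ℝ)).continuous.measurable.sub
      θ'.continuous.measurable).pow_const 2).aestronglyMeasurable
  · refine Eventually.of_forall fun x => ?_
    rw [Real.norm_eq_abs, abs_pow]
    exact pow_le_pow_left₀ (abs_nonneg _) (hB θ θ.2 x) 2

/-- Uniform deviation of the excess risk over a sieve contained in an affine space of dimension at
most `m`. -/
theorem measure_pi_offsetExcess_le [CompactSpace S] [T2Space S] [SecondCountableTopology S]
    (hτ : τ ∈ Set.Ioo (0 : ℝ) 1) {B c L l : ℝ} (hB0 : 0 ≤ B) (hc : 0 ≤ c) (hl0 : 0 ≤ l)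
    (hL : 1 + 2 * B * c ≤ L) (hl : 2 * l * L ^ 2 = c) (θ₀ θ' : C(S, ℝ)) {A : Set C(S, ℝ)}
    (hB : ∀ θ ∈ A, ∀ x, |θ x - θ' x| ≤ B) (V : Submodule ℝ (S → ℝ)) [FiniteDimensional ℝ V]
    {m : ℕ} (hV : Module.finrank ℝ V ≤ m) (hAV : ∀ θ ∈ A, (fun x => θ x - θ' x) ∈ V)
    (n : ℕ) (s : ℝ) :
    (Measure.pi fun _ : Fin n => ν ⊗ₘ κ)
      {z | ∃ θ ∈ A, s < l * ∑ i, offsetExcess ν κ τ c θ₀ θ' θ (z i)} ≤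
      ENNReal.ofReal (Real.exp (-s) * gaussianExpSq ^ m) := by
  obtain ⟨A₀, hA₀, hd⟩ := TopologicalSpace.exists_countable_dense A
  have : Countable A₀ := hA₀.to_subtype
  set E : (S → ℝ) →ₗ[ℝ] (S × ℝ → ℝ) := LinearMap.funLeft ℝ ℝ Prod.fst
  have hL0 : 0 ≤ L := by nlinarith [mul_nonneg hB0 hc]
  have hlL : 0 ≤ l * L := mul_nonneg hl0 hL0
  -- The loss is `1`-Lipschitz and the square adds at most `2 * B * c`; this is why `L` must be at
  -- least `1 + 2 * B * c`.
  have hlip : ∀ θ₁ ∈ A, ∀ θ₂ ∈ A, ∀ q : S × ℝ,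
      |l * (excessLoss τ θ₀ θ' θ₁ q - c * (θ₁ q.1 - θ' q.1) ^ 2) -
        l * (excessLoss τ θ₀ θ' θ₂ q - c * (θ₂ q.1 - θ' q.1) ^ 2)| ≤
      |l * L * (θ₁ q.1 - θ' q.1) - l * L * (θ₂ q.1 - θ' q.1)| := by
    intro θ₁ h₁ θ₂ h₂ q
    have e1 := abs_excessLoss_sub_le hτ θ₀ θ' θ₁ θ₂ q
    have e2 := hB θ₁ h₁ q.1
    have e3 := hB θ₂ h₂ q.1
    rw [← mul_sub, ← mul_sub, abs_mul, abs_mul, abs_of_nonneg hl0, abs_of_nonneg hlL, mul_assoc]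
    refine mul_le_mul_of_nonneg_left ?_ hl0
    rw [sub_sub_sub_cancel_right]
    calc _ = |(excessLoss τ θ₀ θ' θ₁ q - excessLoss τ θ₀ θ' θ₂ q) +
          -(c * ((θ₁ q.1 - θ' q.1) + (θ₂ q.1 - θ' q.1))) * (θ₁ q.1 - θ₂ q.1)| := by
          congr 1
          ring
      _ ≤ |θ₁ q.1 - θ₂ q.1| + c * (B + B) * |θ₁ q.1 - θ₂ q.1| := by
          refine (abs_add_le _ _).trans (add_le_add e1 ?_)
          rw [abs_mul, abs_neg, abs_mul, abs_of_nonneg hc]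
          gcongr
          exact (abs_add_le _ _).trans (add_le_add e2 e3)
      _ = (1 + 2 * B * c) * |θ₁ q.1 - θ₂ q.1| := by ring
      _ ≤ _ := by gcongr
  have hdom : ∀ θ ∈ A, ∀ q : S × ℝ,
      |l * (excessLoss τ θ₀ θ' θ q - c * (θ q.1 - θ' q.1) ^ 2)| ≤
      |l * L * (θ q.1 - θ' q.1)| := by
    intro θ h q
    have e2 := hB θ h q.1
    rw [abs_mul, abs_mul, abs_of_nonneg hl0, abs_of_nonneg hlL, mul_assoc]
    refine mul_le_mul_of_nonneg_left ?_ hl0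
    calc _ ≤ |excessLoss τ θ₀ θ' θ q| + |c * (θ q.1 - θ' q.1) ^ 2| := abs_sub _ _
      _ ≤ |θ q.1 - θ' q.1| + c * (B * |θ q.1 - θ' q.1|) := by
          refine add_le_add (abs_excessLoss_le hτ θ₀ θ' θ q) ?_
          rw [abs_mul, abs_of_nonneg hc, abs_pow, sq]
          gcongr
      _ ≤ (1 + 2 * B * c) * |θ q.1 - θ' q.1| := by
          nlinarith [mul_nonneg (mul_nonneg hB0 hc) (abs_nonneg (θ q.1 - θ' q.1))]
      _ ≤ _ := by gcongr
  have hbd : ∀ θ ∈ A, ∀ q : S × ℝ, |l * L * (θ q.1 - θ' q.1)| ≤ l * L * B := by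
    intro θ h q
    rw [abs_mul, abs_of_nonneg hlL]
    exact mul_le_mul_of_nonneg_left (hB θ h q.1) hlL
  have key := measure_pi_offset_le (ν ⊗ₘ κ)
    (f := fun (θ : A₀) q => l * (excessLoss τ θ₀ θ' (θ : C(S, ℝ)) q -
      c * ((θ : C(S, ℝ)) q.1 - θ' q.1) ^ 2))
    (h := fun (θ : A₀) q => l * L * ((θ : C(S, ℝ)) q.1 - θ' q.1)) (B := l * L * B)
    (fun θ => ((measurable_excessLoss θ₀.continuous.measurable θ'.continuous.measurable
      (θ : C(S, ℝ)).continuous.measurable).sub (((((θ : C(S, ℝ)).continuous.measurable.sub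
      θ'.continuous.measurable).comp measurable_fst).pow_const 2).const_mul c)).const_mul l)
    (fun θ => (((θ : C(S, ℝ)).continuous.measurable.sub
      θ'.continuous.measurable).comp measurable_fst).const_mul _)
    (fun θ q => (hdom θ θ.1.2 q).trans (hbd θ θ.1.2 q)) (fun θ q => hbd θ θ.1.2 q)
    (fun θ q => hdom θ θ.1.2 q) (fun θ₁ θ₂ q => hlip θ₁ θ₁.1.2 θ₂ θ₂.1.2 q) (V.map E)
    ((Submodule.finrank_map_le E V).trans hV)
    (fun θ => (V.map E).smul_mem (l * L) (Submodule.mem_map_of_mem (f := E) (hAV θ θ.1.2))) n s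
  refine (measure_mono ?_).trans key
  rintro z ⟨θ, hθ, hs⟩
  have hcont : Continuous fun θ : A => l * ∑ i, offsetExcess ν κ τ c θ₀ θ' (θ : C(S, ℝ)) (z i) :=
    continuous_const.mul (continuous_finsetSum _ fun i _ =>
      continuous_offsetExcess ν κ hτ θ₀ θ' hB (z i))
  obtain ⟨θ₁, h₁, h₁'⟩ := hd.exists_mem_open (hcont.isOpen_preimage _ isOpen_Ioi)
    ⟨⟨θ, hθ⟩, Set.mem_preimage.2 (Set.mem_Ioi.2 hs)⟩
  refine ⟨⟨θ₁, h₁⟩, ?_⟩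
  simp_rw [offsetTerm_eq_mul_offsetExcess ν κ hτ hl θ₀ θ' θ₁ (hB θ₁ θ₁.2)]
  rw [← Finset.mul_sum]
  exact h₁'

/-- The deterministic part of the rate: an oracle inequality on the event that the offset process
is at most `s`. -/
theorem l2Dist_sq_le_of_offsetExcess_le (hτ : τ ∈ Set.Ioo (0 : ℝ) 1) {B c₀ C₁ η l s : ℝ}
    (hc₀ : 0 < c₀) (hC₁ : 0 ≤ C₁) (hl : 0 < l) {θ₀ θ' θ : C(S, ℝ)}
    (hB : ∀ x, |θ x - θ₀ x| ≤ B) (hη : ∀ x, |θ' x - θ₀ x| ≤ η)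
    (hlow : ∀ x a, |a| ≤ B → c₀ * a ^ 2 ≤ ∫ v, (checkLoss τ (v - a) - checkLoss τ v) ∂(κ x))
    (hup : ∀ x a, |a| ≤ η → ∫ v, (checkLoss τ (v - a) - checkLoss τ v) ∂(κ x) ≤ C₁ * a ^ 2)
    {n : ℕ} (hn : 0 < n) {z : Fin n → S × ℝ} (hmin : ∑ i, excessLoss τ θ₀ θ' θ (z i) ≤ 0)
    (hs : l * ∑ i, offsetExcess ν κ τ (c₀ / 8) θ₀ θ' θ (z i) ≤ s) :
    l2Dist ν θ θ₀ ^ 2 ≤ 2 / c₀ * ((C₁ + c₀ / 2) * η ^ 2 + s / (l * n)) := by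
  have m₀ := θ₀.continuous.measurable
  have m' := θ'.continuous.measurable
  have m := θ.continuous.measurable
  have hD : l2Dist ν θ θ₀ ^ 2 = ∫ x, (θ x - θ₀ x) ^ 2 ∂ν :=
    Real.sq_sqrt (integral_nonneg fun x => sq_nonneg _)
  set Δ := ∫ x, (θ x - θ₀ x) ^ 2 ∂ν with hΔ
  have h1 := mul_integral_sq_le_integral_excessLoss ν κ hτ m₀ m hB hlow
  have h2 := integral_excessLoss_le ν κ hτ hC₁ m₀ m' hη hup
  have h3 : ∫ q, excessLoss τ θ₀ θ' θ q ∂(ν ⊗ₘ κ) = ∫ q, excessLoss τ θ₀ θ₀ θ q ∂(ν ⊗ₘ κ) -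
      ∫ q, excessLoss τ θ₀ θ₀ θ' q ∂(ν ⊗ₘ κ) := by
    rw [← integral_sub (integrable_excessLoss ν κ hτ m₀ m₀ m hB)
      (integrable_excessLoss ν κ hτ m₀ m₀ m' hη)]
    simp [excessLoss]
  have h4 : ∫ x, (θ x - θ' x) ^ 2 ∂ν ≤ 2 * Δ + 2 * η ^ 2 := by
    have i1 := integrable_sub_sq ν θ₀ θ hB
    calc _ ≤ ∫ x, (2 * (θ x - θ₀ x) ^ 2 + 2 * η ^ 2) ∂ν := by
          refine integral_mono (integrable_sub_sq ν θ' θ (B := B + η) fun x => ?_)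
            ((i1.const_mul 2).add (integrable_const _)) fun x => ?_
          · have := abs_sub_le (θ x) (θ₀ x) (θ' x)
            rw [abs_sub_comm (θ₀ x)] at this
            linarith [hB x, hη x]
          · have e1 : (θ' x - θ₀ x) ^ 2 ≤ η ^ 2 := by
              rw [← sq_abs]
              exact pow_le_pow_left₀ (abs_nonneg _) (hη x) 2
            simp only
            nlinarith [sq_nonneg ((θ x - θ₀ x) + (θ' x - θ₀ x))]
      _ = _ := by
          rw [integral_add (i1.const_mul 2) (integrable_const _), integral_const_mul]
          simp [hΔ]
  have hn' : (0 : ℝ) < n := by exact_mod_cast hn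
  have h5 : n * (∫ q, excessLoss τ θ₀ θ' θ q ∂(ν ⊗ₘ κ) -
      2 * (c₀ / 8) * ∫ x, (θ x - θ' x) ^ 2 ∂ν) ≤ s / l := by
    rw [le_div_iff₀ hl, mul_comm]
    refine le_trans (mul_le_mul_of_nonneg_left ?_ hl.le) hs
    unfold offsetExcess
    simp only [Finset.sum_sub_distrib, Finset.sum_const, Finset.card_univ, Fintype.card_fin,
      nsmul_eq_mul]
    linarith
  have h6 : ∫ q, excessLoss τ θ₀ θ' θ q ∂(ν ⊗ₘ κ) -
      2 * (c₀ / 8) * ∫ x, (θ x - θ' x) ^ 2 ∂ν ≤ s / (l * n) := by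
    rw [← div_div, le_div_iff₀ hn', mul_comm]
    exact h5
  -- With offset `c₀ / 8`, the penalty is at most `(c₀ / 4) (2 Δ + 2 η²)`, so half of `c₀ Δ`
  -- survives on the left.
  rw [hD, div_mul_eq_mul_div, le_div_iff₀ hc₀]
  nlinarith [mul_le_mul_of_nonneg_left h4 hc₀.le]

end ExcessLoss

/-! ### Dimension and approximation properties of the sieve. -/

section Sieve

/-- The additive sieve functions, as a linear subspace of the functions on `𝒳`. -/
noncomputable def sieveSubmodule {D k : ℕ} (𝒳 : Set (EuclideanSpace ℝ (Fin D)))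
    (φ : Fin k → C(ℝ, ℝ)) : Submodule ℝ (𝒳 → ℝ) :=
  LinearMap.range
    ({ toFun := fun a z => sieveFun 𝒳 φ a z
       map_add' := fun a b => by
         ext z
         simp [sieveFun, add_mul, Finset.sum_add_distrib]
       map_smul' := fun c a => by
         ext z
         simp [sieveFun, Finset.mul_sum, mul_assoc] } : (Fin D → Fin k → ℝ) →ₗ[ℝ] (𝒳 → ℝ))

instance {D k : ℕ} (𝒳 : Set (EuclideanSpace ℝ (Fin D))) (φ : Fin k → C(ℝ, ℝ)) :
    FiniteDimensional ℝ (sieveSubmodule 𝒳 φ) := by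
  unfold sieveSubmodule
  infer_instance

theorem finrank_sieveSubmodule_le {D k : ℕ} (𝒳 : Set (EuclideanSpace ℝ (Fin D)))
    (φ : Fin k → C(ℝ, ℝ)) : Module.finrank ℝ (sieveSubmodule 𝒳 φ) ≤ D * k := by
  refine (LinearMap.finrank_range_le _).trans (le_of_eq ?_)
  simp [Module.finrank_pi_fintype]

theorem mem_sieveSubmodule_of_mem_sieveSpan {D k : ℕ} {𝒳 : Set (EuclideanSpace ℝ (Fin D))}
    {φ : Fin k → C(ℝ, ℝ)} {θ : C(𝒳, ℝ)} (h : θ ∈ sieveSpan 𝒳 φ) :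
    (fun x => θ x) ∈ sieveSubmodule 𝒳 φ := by
  obtain ⟨a, rfl⟩ := h
  exact ⟨a, rfl⟩

theorem abs_sieveFun_sub_le {D R k : ℕ} {𝒳 : Set (EuclideanSpace ℝ (Fin D))}
    {φ : Fin k → C(ℝ, ℝ)} {b : Fin R → Fin D → Fin k → ℝ} {f : EuclideanSpace ℝ (Fin R)}
    {g : Fin R → ℝ} {z : 𝒳} {e M : ℝ} (hf : ‖f‖ ≤ M)
    (he : ∀ r, |g r - sieveFun 𝒳 φ (b r) z| ≤ e) :
    |sieveFun 𝒳 φ (fun d j => ∑ r, b r d j * f r) z - ∑ r, g r * f r| ≤ R * (e * M) := by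
  have h1 : sieveFun 𝒳 φ (fun d j => ∑ r, b r d j * f r) z =
      ∑ r, sieveFun 𝒳 φ (b r) z * f r := by
    simp only [sieveFun, ContinuousMap.coe_mk, Finset.sum_mul]
    rw [Finset.sum_comm' (t' := Finset.univ) (s' := fun _ => Finset.univ) (by simp)]
    rw [Finset.sum_comm]
    conv_rhs => rw [Finset.sum_comm]
    refine Finset.sum_congr rfl fun d _ => ?_
    conv_rhs => rw [Finset.sum_comm]
    refine Finset.sum_congr rfl fun j _ => Finset.sum_congr rfl fun r _ => ?_
    ring
  rw [h1, ← Finset.sum_sub_distrib]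
  refine (Finset.abs_sum_le_sum_abs _ _).trans ?_
  calc _ ≤ ∑ _r : Fin R, e * M := by
        refine Finset.sum_le_sum fun r _ => ?_
        rw [← sub_mul, abs_mul, abs_sub_comm]
        exact mul_le_mul (he r) ((PiLp.norm_apply_le f r).trans hf) (abs_nonneg _)
          ((abs_nonneg _).trans (he r))
    _ = _ := by simp

end Sieve

/-! ### Comparison of `(a + ln T + b k) / n` with the squared rate. -/

section Rate

theorem sieveRate_nonneg (α : ℝ) (n k : ℕ) : 0 ≤ sieveRate α n k :=
  le_max_of_le_left (Real.sqrt_nonneg _)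

theorem sieveRate_le_panelRate (α : ℝ) (n k T : ℕ) : sieveRate α n k ≤ panelRate α n k T :=
  le_mul_of_one_le_left (sieveRate_nonneg α n k) (le_max_right _ _)

theorem panelRate_nonneg (α : ℝ) (n k T : ℕ) : 0 ≤ panelRate α n k T :=
  (sieveRate_nonneg α n k).trans (sieveRate_le_panelRate α n k T)

theorem rpow_neg_le_panelRate (α : ℝ) (n k T : ℕ) : (k : ℝ) ^ (-α) ≤ panelRate α n k T :=
  (le_max_right _ _).trans (sieveRate_le_panelRate α n k T)

theorem max_log_mul_le_panelRate_sq (α : ℝ) (n k T : ℕ) :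
    max (Real.log T) 1 * (k / n) ≤ panelRate α n k T ^ 2 := by
  have h1 : (k / n : ℝ) ≤ sieveRate α n k ^ 2 := by
    calc (k / n : ℝ) = √(k / n) ^ 2 := (Real.sq_sqrt (by positivity)).symm
      _ ≤ _ := pow_le_pow_left₀ (Real.sqrt_nonneg _) (le_max_left _ _) 2
  have h2 : max (Real.log T) 1 ≤ max √(Real.log T) 1 ^ 2 := by
    refine max_le ?_ (one_le_pow₀ (le_max_right _ _))
    rw [← Real.sq_sqrt (Real.log_natCast_nonneg T)]
    exact pow_le_pow_left₀ (Real.sqrt_nonneg _) (by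
      rw [Real.sq_sqrt (Real.log_natCast_nonneg T)]
      exact le_max_left _ _) 2
  rw [panelRate, mul_pow]
  exact mul_le_mul h2 h1 (by positivity) (by positivity)

theorem log_add_div_le_panelRate_sq (α : ℝ) {n k T : ℕ} (hk : 1 ≤ k) {a b : ℝ}
    (hb : 0 ≤ b) : (a + Real.log T + b * k) / n ≤ (|a| + 1 + b) * panelRate α n k T ^ 2 := by
  have hk' : (1 : ℝ) ≤ k := by exact_mod_cast hk
  refine le_trans ?_ (mul_le_mul_of_nonneg_left (max_log_mul_le_panelRate_sq α n k T)
    (by positivity))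
  set m := max (Real.log T) 1 with hm
  have hm1 : 1 ≤ m := le_max_right _ _
  have hlm : Real.log T ≤ m := le_max_left _ _
  rw [← mul_div_assoc, ← mul_div_assoc]
  refine div_le_div_of_nonneg_right ?_ (Nat.cast_nonneg n)
  have hmk : m ≤ m * k := le_mul_of_one_le_right (by linarith) hk'
  have hkm : (k : ℝ) ≤ m * k := le_mul_of_one_le_left (by linarith) hm1
  have h1 : |a| * 1 ≤ |a| * (m * k) :=
    mul_le_mul_of_nonneg_left (hm1.trans hmk) (abs_nonneg a)
  have h2 : b * k ≤ b * (m * k) := mul_le_mul_of_nonneg_left hkm hb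
  have h3 := le_abs_self a
  nlinarith

end Rate

/-! ### Quadratic bounds uniform in the conditioning value. -/

section Bounds

variable {τ : ℝ} {S : Type*} [MeasurableSpace S] (κ : Kernel S ℝ) [IsMarkovKernel κ]

/-- Quadratic bounds on the conditional expected loss, uniformly in the conditioning value. -/
theorem exists_quadratic_bounds (hτ : τ ∈ Set.Ioo (0 : ℝ) 1)
    (hq : ∀ z, κ z (Set.Iic 0) = ENNReal.ofReal τ) {dens : S → ℝ → ℝ}
    (hdens : ∀ z, κ z = volume.withDensity fun v => ENNReal.ofReal (dens z v))
    (hlow : ∃ c : ℝ, 0 < c ∧ ∀ z, c ≤ dens z 0) (hup : ∃ c : ℝ, ∀ z, dens z 0 ≤ c)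
    (hcont : TendstoUniformly (fun v z => dens z v) (fun z => dens z 0) (𝓝 0)) {B : ℝ}
    (hB : 0 < B) :
    ∃ c₀ > 0, ∃ C₁ ≥ 0, ∃ δ > 0,
      (∀ z a, |a| ≤ B → c₀ * a ^ 2 ≤ ∫ v, (checkLoss τ (v - a) - checkLoss τ v) ∂(κ z)) ∧
      ∀ z a, |a| < δ → ∫ v, (checkLoss τ (v - a) - checkLoss τ v) ∂(κ z) ≤ C₁ * a ^ 2 := by
  obtain ⟨c, hc, hcl⟩ := hlow
  obtain ⟨C, hC⟩ := hup
  obtain ⟨δ, hδ, h⟩ := Metric.eventually_nhds_iff.1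
    (Metric.tendstoUniformly_iff.1 hcont (c / 2) (by positivity))
  have h' : ∀ z v, |v| < δ → |dens z 0 - dens z v| < c / 2 := fun z v hv => by
    simpa [Real.dist_eq] using h (y := v) (by simpa using hv) z
  -- Within the radius `δ` the density moves by less than `c / 2`, hence stays between `c / 2` and
  -- `|C| + c / 2`.
  refine ⟨c / 2 / 8 * min 1 (δ / B), by positivity, 2 * (|C| + c / 2), by positivity, δ, hδ,
    fun z a ha => ?_, fun z a ha => ?_⟩
  · refine mul_sq_le_integral_checkLoss_sub hτ (hq z) (hdens z) (by positivity) hδ hB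
      (fun v hv => ?_) ha
    have := abs_lt.1 (h' z v hv)
    linarith [hcl z]
  · refine integral_checkLoss_sub_le hτ (hq z) (hdens z) (by positivity) (fun v hv => ?_) ha
    have := abs_lt.1 (h' z v hv)
    linarith [hC z, le_abs_self C]

end Bounds

/-! ### From a single period to the maximum over periods. -/

/-- The law of the cross-section of one period. -/
theorem map_cross_section_eq_pi {Ω S : Type*} [MeasurableSpace Ω] [MeasurableSpace S]
    {P : Measure Ω} [IsProbabilityMeasure P] {n T : ℕ} {x : ℕ → Ω → S} {u : ℕ → ℕ → Ω → ℝ}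
    (hx : ∀ i, Measurable (x i)) (hu : ∀ i t, Measurable (u i t)) {μ : Measure (S × ℝ)}
    (hμ : ∀ i < n, ∀ t < T, P.map (fun ω => (x i ω, u i t ω)) = μ)
    (hindep : iIndepFun (fun (i : Fin n) ω => ((fun t : Fin T => u i t ω), x i ω)) P) {t : ℕ}
    (ht : t < T) :
    P.map (fun ω (i : Fin n) => (x i ω, u i t ω)) = Measure.pi fun _ => μ := by
  have h := hindep.comp (fun _ p => (p.2, p.1 ⟨t, ht⟩)) fun _ =>
    measurable_snd.prodMk ((measurable_pi_apply _).comp measurable_fst)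
  have h1 := (iIndepFun_iff_map_fun_eq_pi_map fun i : Fin n =>
    ((hx i).prodMk (hu i t)).aemeasurable).1 h
  rw [h1]
  congr 1
  ext1 i
  exact hμ i i.2 t ht

theorem sum_excessLoss_nonpos_of_isSieveEstimator {S : Type*} [TopologicalSpace S] {τ : ℝ} {n : ℕ}
    (hn : 0 < n) {y u : ℕ → ℝ} {x : ℕ → S} {θ₀ : S → ℝ} {A : Set C(S, ℝ)} {θ θ' : C(S, ℝ)}
    (hy : ∀ i < n, y i = θ₀ (x i) + u i) (hθ : IsSieveEstimator τ n y x θ₀ A θ) (hθ' : θ' ∈ A) :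
    ∑ i : Fin n, excessLoss τ θ₀ θ' θ (x i, u i) ≤ 0 := by
  have h := hθ.2 θ' hθ'
  unfold sampleCriterion at h
  have hn' : (0 : ℝ) < (n : ℝ)⁻¹ := by positivity
  have h1 := le_of_mul_le_mul_left h hn'
  rw [Finset.sum_range, Finset.sum_range, ← sub_nonpos, ← Finset.sum_sub_distrib] at h1
  refine le_trans (le_of_eq (Finset.sum_congr rfl fun i _ => ?_)) h1
  unfold excessLoss
  rw [hy i i.2]
  simp only
  rw [show u i - (θ (x i) - θ₀ (x i)) = θ₀ (x i) + u i - θ (x i) by ring,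
    show u i - (θ' (x i) - θ₀ (x i)) = θ₀ (x i) + u i - θ' (x i) by ring]
  ring

/-- Indices start at `0`: units are `i < n`, periods are `t < T n`. -/
theorem proposition1
    {Ω : Type*} [MeasurableSpace Ω] (P : Measure Ω) [IsProbabilityMeasure P]
    (τ : ℝ) (hτ : τ ∈ Set.Ioo (0 : ℝ) 1)
    (D R : ℕ)
    -- the period length: fixed, or growing with `n`
    (T : ℕ → ℕ) (hT1 : ∀ n, 1 ≤ T n)
    (hT : (∃ T₀, ∀ n, T n = T₀) ∨ Tendsto T atTop atTop)
    -- characteristics with support `𝒳`, and idiosyncratic errors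
    (𝒳 : Set (EuclideanSpace ℝ (Fin D)))
    (x : ℕ → Ω → 𝒳) (hx : ∀ i, Measurable (x i))
    (h𝒳 : (P.map (fun ω => (x 0 ω : EuclideanSpace ℝ (Fin D)))).support = 𝒳)
    (u : ℕ → ℕ → Ω → ℝ) (hu : ∀ i t, Measurable (u i t))
    -- additive loading functions, non-random factors, `θ₀ t = g' f_t`
    (g : Fin R → Fin D → ℝ → ℝ) (f : ℕ → EuclideanSpace ℝ (Fin R))
    (θ₀ : ℕ → C(𝒳, ℝ))
    (hθ₀ : ∀ n, ∀ t < T n, ∀ z : 𝒳,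
      θ₀ t z = ∑ r, (∑ d, g r d ((z : EuclideanSpace ℝ (Fin D)) d)) * f t r)
    -- the outcomes
    (y : ℕ → ℕ → Ω → ℝ)
    (hy : ∀ n, ∀ i < n, ∀ t < T n, ∀ ω, y i t ω = θ₀ t (x i ω) + u i t ω)
    -- the parameter space
    (Θ : Set C(𝒳, ℝ)) (hΘ : ∀ n, ∀ t < T n, θ₀ t ∈ Θ)
    -- the regular conditional distribution of the errors given the characteristics, with density
    -- `dens`, and the conditional quantile restriction
    (κ : Kernel 𝒳 ℝ) [IsMarkovKernel κ]
    (hκ : ∀ n, ∀ i < n, ∀ t < T n,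
      P.map (fun ω => (x i ω, u i t ω)) = (P.map (x i)) ⊗ₘ κ)
    (hquant : ∀ z, κ z (Set.Iic 0) = ENNReal.ofReal τ)
    (dens : 𝒳 → ℝ → ℝ) (hdens_meas : ∀ z, Measurable (dens z)) (hdens_nonneg : ∀ z v, 0 ≤ dens z v)
    (hdens : ∀ z, κ z = volume.withDensity (fun v => ENNReal.ofReal (dens z v)))
    -- (i) i.i.d. across units, identical marginals across periods
    (hindep : ∀ n, iIndepFun
      (fun (i : Fin n) ω => ((fun t : Fin (T n) => u i t ω), x i ω)) P)
    (hident : ∀ n, ∀ i < n, ∀ j < n, IdentDistrib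
      (fun ω => ((fun t : Fin (T n) => u i t ω), x i ω))
      (fun ω => ((fun t : Fin (T n) => u j t ω), x j ω)) P P)
    (hident_t : ∀ n, ∀ i < n, ∀ s < T n, ∀ t < T n, IdentDistrib
      (fun ω => (u i s ω, x i ω)) (fun ω => (u i t ω, x i ω)) P P)
    -- (ii) sieve approximation of the loading functions, with `π_n θ₀ t ∈ Θ_n`
    (k : ℕ → ℕ) (φ : (n : ℕ) → Fin (k n) → C(ℝ, ℝ))
    (α : ℝ) (hα : 1 ≤ α)
    (b : (n : ℕ) → Fin R → Fin D → Fin (k n) → ℝ)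
    (happrox : ∃ C : ℝ, ∀ᶠ n in atTop, ∀ r, ∀ z : 𝒳,
      |(∑ d, g r d ((z : EuclideanSpace ℝ (Fin D)) d)) - sieveFun 𝒳 (φ n) (b n r) z|
        ≤ C * (k n : ℝ) ^ (-α))
    (hproj : ∀ᶠ n in atTop, ∀ t < T n,
      sieveFun 𝒳 (φ n) (fun d j => ∑ r, b n r d j * f t r) ∈ sieveSet Θ (φ n))
    -- (iii) boundedness
    (h𝒳_bdd : Bornology.IsBounded 𝒳)
    (hbdd : ∃ M : ℝ, (∀ θ ∈ Θ, ∀ z, |θ z| < M) ∧ ∀ n, ∀ t < T n, ‖f t‖ < M)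
    -- (iv) the conditional density near `0`
    (hdens_lower : ∃ c : ℝ, 0 < c ∧ ∀ z, c ≤ dens z 0)
    (hdens_upper : ∃ c : ℝ, ∀ z, dens z 0 ≤ c)
    (hdens_cont : TendstoUniformly (fun v z => dens z v) (fun z => dens z 0) (𝓝 0))
    -- (v) growth of the sieve
    (hk : Tendsto k atTop atTop)
    (hrate : Tendsto (fun n => panelRate α n (k n) (T n)) atTop (𝓝 0))
    -- the sieve quantile regression estimators (with probability tending to one)
    (θhat : ℕ → ℕ → Ω → C(𝒳, ℝ))
    (hθhat : Tendsto (fun n => P {ω | ¬ ∀ t < T n,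
      IsSieveEstimator τ n (fun i => y i t ω) (fun i => x i ω) (θ₀ t)
        (sieveSet Θ (φ n)) (θhat n t ω)}) atTop (𝓝 0)) :
    IsBigOP P
      (fun n ω => ⨆ t : Fin (T n), l2Dist (P.map (x 0)) (θhat n t ω) (θ₀ t))
      (fun n => panelRate α n (k n) (T n)) := by
  -- A support is closed, so bounded means compact here; compactness makes `C(𝒳, ℝ)` separable.
  have hcpt : CompactSpace 𝒳 := by
    rw [← isCompact_iff_compactSpace]
    refine Metric.isCompact_of_isClosed_isBounded ?_ h𝒳_bdd
    rw [← h𝒳]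
    exact Measure.isClosed_support
  obtain ⟨M₀, hM₀, hfM₀⟩ := hbdd
  set M := max M₀ 1
  have hM1 : 1 ≤ M := le_max_right _ _
  have hM : ∀ θ ∈ Θ, ∀ z, |θ z| ≤ M := fun θ hθ z => (hM₀ θ hθ z).le.trans (le_max_left _ _)
  have hfM : ∀ n, ∀ t < T n, ‖f t‖ ≤ M := fun n t ht => (hfM₀ n t ht).le.trans (le_max_left _ _)
  have hΘB : ∀ θ₁ ∈ Θ, ∀ θ₂ ∈ Θ, ∀ z, |θ₁ z - θ₂ z| ≤ 2 * M := fun θ₁ h₁ θ₂ h₂ z => by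
    have := (abs_sub (θ₁ z) (θ₂ z)).trans (add_le_add (hM θ₁ h₁ z) (hM θ₂ h₂ z))
    linarith
  obtain ⟨c₀, hc₀, C₁, hC₁, δ₁, hδ₁, hlow, hup⟩ := exists_quadratic_bounds κ hτ hquant hdens
    hdens_lower hdens_upper hdens_cont (B := 2 * M) (by positivity)
  obtain ⟨C₂, hC₂⟩ := happrox
  set ν := P.map (x 0) with hν
  have : IsProbabilityMeasure ν := Measure.isProbabilityMeasure_map (hx 0).aemeasurable
  have hlaw : ∀ n, ∀ i < n, ∀ t < T n, P.map (fun ω => (x i ω, u i t ω)) = ν ⊗ₘ κ := by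
    intro n i hi t ht
    have h1 : P.map (x i) = ν :=
      ((hident n i hi 0 (by omega)).comp measurable_snd).map_eq
    rw [hκ n i hi t ht, h1]
  set c := c₀ / 8 with hc
  set L := 1 + 2 * (2 * M) * c with hL
  have hc0 : 0 < c := by positivity
  have hL0 : 0 < L := by positivity
  set l := c / (2 * L ^ 2) with hl
  have hl0 : 0 < l := by positivity
  have hlL : 2 * l * L ^ 2 = c := by
    rw [hl]
    field_simp
  have hlogK : 0 ≤ Real.log gaussianExpSq := Real.log_nonneg one_le_gaussianExpSq
  set C₃ := R * (|C₂| * M) with hC₃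
  have hC₃0 : 0 ≤ C₃ := by positivity
  intro δ hδ
  set a := Real.log (2 / δ) with ha
  set b₀ := D * Real.log gaussianExpSq with hb₀
  have hb₀0 : 0 ≤ b₀ := by positivity
  set Q := 2 / c₀ * ((C₁ + c₀ / 2) * C₃ ^ 2 + (|a| + 1 + b₀) / l) with hQ
  have hQ0 : 0 ≤ Q := by positivity
  -- `Q + 1` is positive and satisfies `Q ≤ (Q + 1) ^ 2`, which spares a square root.
  refine ⟨Q + 1, by linarith, ?_⟩
  have hη : ∀ᶠ n in atTop, C₃ * panelRate α n (k n) (T n) < δ₁ := by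
    have := hrate.const_mul C₃
    rw [mul_zero] at this
    exact this.eventually_lt_const hδ₁
  have hest : ∀ᶠ n in atTop, P {ω | ¬ ∀ t < T n,
      IsSieveEstimator τ n (fun i => y i t ω) (fun i => x i ω) (θ₀ t)
        (sieveSet Θ (φ n)) (θhat n t ω)} ≤ ENNReal.ofReal (δ / 2) :=
    hθhat.eventually_le_const (by simpa using hδ)
  filter_upwards [hη, hest, hC₂, hproj, hk.eventually_ge_atTop 1, eventually_gt_atTop 0]
    with n hηn hestn hapn hprojn hkn hn
  set r := panelRate α n (k n) (T n) with hr
  have hr0 : 0 ≤ r := panelRate_nonneg _ _ _ _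
  have hT0 : (0 : ℝ) < T n := by exact_mod_cast hT1 n
  set s := a + Real.log (T n) + b₀ * k n with hs
  -- The level `s` is tuned so that each period fails with probability at most `δ / (2 T)`; the `T`
  -- periods together use half of `δ`, the estimator event the other half.
  have hexp : Real.exp (-s) * gaussianExpSq ^ (D * k n) = δ / (2 * T n) := by
    have hK : gaussianExpSq ^ (D * k n) = Real.exp (b₀ * k n) := by
      rw [hb₀, ← Real.exp_log (zero_lt_one.trans_le one_le_gaussianExpSq), ← Real.exp_nat_mul,
        Real.log_exp]
      push_cast
      ring_nf
    rw [hK, ← Real.exp_add, show -s + b₀ * k n = -(a + Real.log (T n)) by rw [hs]; ring,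
      Real.exp_neg, Real.exp_add, ha, Real.exp_log (by positivity), Real.exp_log hT0]
    field_simp
  set proj : ℕ → C(𝒳, ℝ) := fun t => sieveFun 𝒳 (φ n) (fun d j => ∑ r, b n r d j * f t r)
    with hprojdef
  set bad : ℕ → Set (Fin n → 𝒳 × ℝ) := fun t => {z | ∃ θ ∈ sieveSet Θ (φ n),
    s < l * ∑ i, offsetExcess ν κ τ c (θ₀ t) (proj t) θ (z i)} with hbad
  set W : ℕ → Ω → Fin n → 𝒳 × ℝ := fun t ω i => (x i ω, u i t ω) with hW
  have hbadP : ∀ t < T n, P (W t ⁻¹' bad t) ≤ ENNReal.ofReal (δ / (2 * T n)) := by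
    intro t ht
    have hWm : Measurable (W t) := measurable_pi_lambda _ fun i => (hx i).prodMk (hu i t)
    -- The bad event need not be measurable; for outer measure this inequality suffices.
    refine (Measure.le_map_apply hWm.aemeasurable _).trans ?_
    rw [hW, map_cross_section_eq_pi hx hu (hlaw n) (hindep n) ht, ← hexp]
    refine measure_pi_offsetExcess_le ν κ hτ (B := 2 * M) (by positivity) hc0.le hl0.le le_rfl hlL
      (θ₀ t) (proj t) (fun θ hθ => hΘB θ hθ.2 _ (hprojn t ht).2) (sieveSubmodule 𝒳 (φ n))
      (finrank_sieveSubmodule_le _ _) (fun θ hθ => ?_) n s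
    exact (sieveSubmodule 𝒳 (φ n)).sub_mem (mem_sieveSubmodule_of_mem_sieveSpan hθ.1)
      (mem_sieveSubmodule_of_mem_sieveSpan (hprojn t ht).1)
  have hgood : ∀ t < T n, ∀ ω, W t ω ∉ bad t →
      IsSieveEstimator τ n (fun i => y i t ω) (fun i => x i ω) (θ₀ t)
        (sieveSet Θ (φ n)) (θhat n t ω) → l2Dist ν (θhat n t ω) (θ₀ t) ≤ (Q + 1) * r := by
    intro t ht ω hω hθ
    have hdist : ∀ z, |proj t z - θ₀ t z| ≤ C₃ * r := by
      intro z
      rw [hθ₀ n t ht z]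
      refine (abs_sieveFun_sub_le (hfM n t ht) fun q => hapn q z).trans ?_
      have h1 : C₂ * (k n : ℝ) ^ (-α) ≤ |C₂| * r :=
        mul_le_mul (le_abs_self _) (rpow_neg_le_panelRate _ _ _ _) (by positivity) (abs_nonneg _)
      calc (R : ℝ) * (C₂ * (k n : ℝ) ^ (-α) * M) ≤ R * (|C₂| * r * M) := by gcongr
        _ = C₃ * r := by rw [hC₃]; ring
    have hmin := sum_excessLoss_nonpos_of_isSieveEstimator hn (u := fun i => u i t ω)
      (fun i hi => hy n i hi t ht ω) hθ (hprojn t ht)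
    have hsω : l * ∑ i, offsetExcess ν κ τ (c₀ / 8) (θ₀ t) (proj t) (θhat n t ω) (W t ω i) ≤ s := by
      by_contra hcon
      exact hω ⟨θhat n t ω, hθ.1, not_le.1 hcon⟩
    have hmain := l2Dist_sq_le_of_offsetExcess_le ν κ hτ hc₀ hC₁ hl0
      (hΘB _ hθ.1.2 _ (hΘ n t ht)) hdist hlow
      (fun z v hv => hup z v (hv.trans_lt hηn)) hn hmin hsω
    have hsn : s / (l * n) ≤ (|a| + 1 + b₀) / l * r ^ 2 := by
      rw [mul_comm l, ← div_div, div_mul_eq_mul_div]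
      exact div_le_div_of_nonneg_right (log_add_div_le_panelRate_sq α hkn hb₀0) hl0.le
    have hsq : l2Dist ν (θhat n t ω) (θ₀ t) ^ 2 ≤ Q * r ^ 2 := by
      refine hmain.trans ?_
      calc _ ≤ 2 / c₀ * ((C₁ + c₀ / 2) * (C₃ * r) ^ 2 + (|a| + 1 + b₀) / l * r ^ 2) := by gcongr
        _ = Q * r ^ 2 := by rw [hQ]; ring
    refine le_of_sq_le_sq ?_ (by positivity)
    refine hsq.trans ?_
    rw [mul_pow]
    exact mul_le_mul_of_nonneg_right (by nlinarith) (sq_nonneg r)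
  have hsub : {ω | (Q + 1) * r < |⨆ t : Fin (T n), l2Dist ν (θhat n t ω) (θ₀ t)|} ⊆
      {ω | ¬ ∀ t < T n, IsSieveEstimator τ n (fun i => y i t ω) (fun i => x i ω) (θ₀ t)
        (sieveSet Θ (φ n)) (θhat n t ω)} ∪ ⋃ t : Fin (T n), W t ⁻¹' bad t := by
    intro ω hω
    by_contra hcon
    rw [Set.mem_union, not_or, Set.mem_iUnion, not_exists] at hcon
    have hE := not_not.1 hcon.1
    have : Nonempty (Fin (T n)) := ⟨⟨0, hT1 n⟩⟩
    refine absurd (Set.mem_ofPred.1 hω) (not_lt.2 ?_)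
    have h0 : ∀ t : Fin (T n), 0 ≤ l2Dist ν (θhat n t ω) (θ₀ t) := fun t => Real.sqrt_nonneg _
    rw [abs_of_nonneg (Real.iSup_nonneg h0)]
    exact ciSup_le fun t => hgood t t.2 ω (hcon.2 t) (hE t t.2)
  calc _ ≤ _ := measure_mono hsub
    _ ≤ ENNReal.ofReal (δ / 2) + ∑ t : Fin (T n), ENNReal.ofReal (δ / (2 * T n)) :=
        (measure_union_le _ _).trans (add_le_add hestn ((measure_iUnion_fintype_le _ _).trans
          (Finset.sum_le_sum fun t _ => hbadP t t.2)))
    _ = ENNReal.ofReal δ := by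
        rw [Finset.sum_const, Finset.card_univ, Fintype.card_fin, nsmul_eq_mul,
          ← ENNReal.ofReal_natCast, ← ENNReal.ofReal_mul hT0.le,
          ← ENNReal.ofReal_add (by positivity) (by positivity)]
        congr 1
        field_simp
        ring
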